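/- Let $k$ be a field and $t\in k$ with $t\neq 0$ and $t\neq 1$. For $m\ge 1$ let $LB_m$ be the loop braid group, generated by $\sigma_1,\dots,\sigma_{m-1},\rho_1,\dots,\rho_{m-1}$ subject to the braid relations for the $\sigma_i$, the symmetric group relations for the $\rho_i$, $\rho_i\sigma_j=\sigma_j\rho_i$ for $|i-j|>1$, $\rho_i\rho_{i+1}\sigma_i=\sigma_{i+1}\rho_i\rho_{i+1}$ and $\rho_i\sigma_{i+1}\sigma_i=\sigma_{i+1}\sigma_i\rho_{i+1}$. Let $V=k^2$ with basis $e_1,e_2$ and, for $s\in k^\times$, let $$M'_s=\begin{pmatrix}1&0&0&0\\0&1-s&s&0\\0&1&0&0\\0&0&0&-s\end{pmatrix}$$ act on $V\otimes V$ with respect to the basis ordered as $e_1\otimes e_1,\ e_2\otimes e_1,\ e_1\otimes e_2,\ e_2\otimes e_2$. Let $F_m$ be the representation of $LB_m$ on $V^{\otimes m}$ in which $\sigma_i$ acts as $M'_t$ and $\rho_i$ as $M'_1$ on the tensor factors $i,i+1$, and as the identity on the other factors. Let $SP_m=kLB_m/\mathrm{Ann}\,F_m$, where $\mathrm{Ann}\,F_m$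 is the ideal of elements of $kLB_m$ that act as zero. For $w\in SP_{m}$ let $w^{(1)}\in SP_{m+1}$ be its image under the algebra map induced by $\sigma_i\mapsto\sigma_{i+1}$, $\rho_i\mapsto\rho_{i+1}$. Let $n\ge 2$ and $\chi_1=\frac{\sigma_1-\rho_1}{1-t}\in SP_n$. Then $\chi_1$ is idempotent, and the map $$f_\chi: SP_{n-1}\to \chi_1\,SP_n\,\chi_1,\qquad w\mapsto \chi_1\,w^{(1)}\,\chi_1,$$ is an isomorphism of $k$-algebras, where $\chi_1 SP_n\chi_1$ has unit element $\chi_1$; in particular $\chi_1 SP_n\chi_1\cong SP_{n-1}$. Moreover, the quotient of $SP_n$ by the two-sided ideal $SP_n\,\chi_1\,SP_n$ is isomorphic to $k$ as a $k$-algebra. -/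

import Mathlib

namespace LoopBraid

/-! ### The loop braid group -/

/-- The letters `σ_i` and `ρ_i`, where `i : Fin (n - 1)` stands for the usual index `i + 1`. -/
inductive Gen (n : ℕ) : Type
  | sig : Fin (n - 1) → Gen n
  | rho : Fin (n - 1) → Gen n

/-- The letter `σ_i` in the free group. -/
def freeSig {n : ℕ} (i : Fin (n - 1)) : FreeGroup (Gen n) := FreeGroup.of (Gen.sig i)

/-- The letter `ρ_i` in the free group. -/
def freeRho {n : ℕ} (i : Fin (n - 1)) : FreeGroup (Gen n) := FreeGroup.of (Gen.rho i)

/-- The pairs of words `(l, r)` such that `l = r` is a defining relation of the loop braid group: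
the braid relations for the `σ_i`, the symmetric group relations for the `ρ_i`, and the mixed
relations. -/
inductive Rel (n : ℕ) : FreeGroup (Gen n) → FreeGroup (Gen n) → Prop
  | sig_braid (i j : Fin (n - 1)) (h : i.val + 1 = j.val) :
      Rel n (freeSig i * freeSig j * freeSig i) (freeSig j * freeSig i * freeSig j)
  | sig_far (i j : Fin (n - 1)) (h : i.val + 1 < j.val) :
      Rel n (freeSig i * freeSig j) (freeSig j * freeSig i)
  | rho_braid (i j : Fin (n - 1)) (h : i.val + 1 = j.val) :
      Rel n (freeRho i * freeRho j * freeRho i) (freeRho j * freeRho i * freeRho j)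
  | rho_far (i j : Fin (n - 1)) (h : i.val + 1 < j.val) :
      Rel n (freeRho i * freeRho j) (freeRho j * freeRho i)
  | rho_sq (i : Fin (n - 1)) : Rel n (freeRho i * freeRho i) 1
  | mixed_far (i j : Fin (n - 1)) (h : i.val + 1 < j.val ∨ j.val + 1 < i.val) :
      Rel n (freeRho i * freeSig j) (freeSig j * freeRho i)
  | mixed_rrs (i j : Fin (n - 1)) (h : i.val + 1 = j.val) :
      Rel n (freeRho i * freeRho j * freeSig i) (freeSig j * freeRho i * freeRho j)
  | mixed_rss (i j : Fin (n - 1)) (h : i.val + 1 = j.val) :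
      Rel n (freeRho i * freeSig j * freeSig i) (freeSig j * freeSig i * freeRho j)

/-- The relators of the loop braid group. -/
def relators (n : ℕ) : Set (FreeGroup (Gen n)) := {x | ∃ l r, Rel n l r ∧ x = l * r⁻¹}

/-- The loop braid group `LB_n`. -/
abbrev LB (n : ℕ) : Type := PresentedGroup (relators n)

/-- The generator `σ_i` of `LB_n`. -/
def sig {n : ℕ} (i : Fin (n - 1)) : LB n := PresentedGroup.of (Gen.sig i)

/-- The generator `ρ_i` of `LB_n`. -/
def rho {n : ℕ} (i : Fin (n - 1)) : LB n := PresentedGroup.of (Gen.rho i)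

/-- The translated index `i + 1`. -/
def shiftIdx {n : ℕ} (i : Fin (n - 1)) : Fin (n + 1 - 1) := ⟨i.val + 1, by omega⟩

/-- Translation of letters. -/
def shiftGen {n : ℕ} : Gen n → Gen (n + 1)
  | Gen.sig i => Gen.sig (shiftIdx i)
  | Gen.rho i => Gen.rho (shiftIdx i)

theorem shift_rel {n : ℕ} {l r : FreeGroup (Gen n)} (h : Rel n l r) :
    Rel (n + 1) (FreeGroup.map shiftGen l) (FreeGroup.map shiftGen r) := by
  cases h <;> simp only [freeSig, freeRho, map_mul, map_one, FreeGroup.map.of, shiftGen]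
  · exact Rel.sig_braid _ _ (by simp only [shiftIdx]; omega)
  · exact Rel.sig_far _ _ (by simp only [shiftIdx]; omega)
  · exact Rel.rho_braid _ _ (by simp only [shiftIdx]; omega)
  · exact Rel.rho_far _ _ (by simp only [shiftIdx]; omega)
  · exact Rel.rho_sq _
  · exact Rel.mixed_far _ _ (by simp only [shiftIdx]; omega)
  · exact Rel.mixed_rrs _ _ (by simp only [shiftIdx]; omega)
  · exact Rel.mixed_rss _ _ (by simp only [shiftIdx]; omega)

/-- Translation `w ↦ w^{(1)}`, `LB_n → LB_{n+1}`, given by `σ_i ↦ σ_{i+1}`, `ρ_i ↦ ρ_{i+1}`. -/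
def shiftLB (n : ℕ) : LB n →* LB (n + 1) :=
  PresentedGroup.map (FreeGroup.map shiftGen) (by
    rintro x ⟨l, r, h, rfl⟩
    exact ⟨_, _, shift_rel h, by simp⟩)

/-! ### The Burau-Rittenberg representation -/

variable {k : Type*} [Field k]

/-- The words of length `n` in two letters, labelling the standard basis of `(k²)^{⊗ n}`:
the letter `0` stands for `e_1` and the letter `1` for `e_2`. -/
abbrev Word (n : ℕ) : Type := Fin n → Fin 2

/-- The matrix `M'_t`; in the basis ordered as `e_1e_1, e_2e_1, e_1e_2, e_2e_2` its rows are
`(1,0,0,0)`, `(0,1-t,t,0)`, `(0,1,0,0)`, `(0,0,0,-t)`. -/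
def matM (t : k) : Matrix (Fin 2 × Fin 2) (Fin 2 × Fin 2) k :=
  Matrix.of fun v w =>
    if v = (0, 0) ∧ w = (0, 0) then 1
    else if v = (1, 0) ∧ w = (1, 0) then 1 - t
    else if v = (1, 0) ∧ w = (0, 1) then t
    else if v = (0, 1) ∧ w = (1, 0) then 1
    else if v = (1, 1) ∧ w = (1, 1) then -t
    else 0

/-- The left one of the two neighbouring tensor positions on which `σ_i` acts. -/
def pos {n : ℕ} (i : Fin (n - 1)) : Fin n := ⟨i.val, by omega⟩

/-- The right one of the two neighbouring tensor positions on which `σ_i` acts. -/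
def posSucc {n : ℕ} (i : Fin (n - 1)) : Fin n := ⟨i.val + 1, by omega⟩

/-- The matrix `1 ⊗ ⋯ ⊗ 1 ⊗ M ⊗ 1 ⊗ ⋯ ⊗ 1` with `M` at positions `i, i + 1`. -/
def localMat {n : ℕ} (M : Matrix (Fin 2 × Fin 2) (Fin 2 × Fin 2) k) (i : Fin (n - 1)) :
    Matrix (Word n) (Word n) k :=
  Matrix.of fun v w =>
    if ∀ j, j ≠ pos i → j ≠ posSucc i → v j = w j then
      M (v (pos i), v (posSucc i)) (w (pos i), w (posSucc i))
    else 0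

theorem pos_ne {n : ℕ} (i : Fin (n - 1)) : pos i ≠ posSucc i := by
  simp [pos, posSucc]

theorem localMat_mulVec {n : ℕ} (M : Matrix (Fin 2 × Fin 2) (Fin 2 × Fin 2) k) (i : Fin (n - 1))
    (f : Word n → k) (v : Word n) :
    (localMat M i).mulVec f v = ∑ ab : Fin 2 × Fin 2, M (v (pos i), v (posSucc i)) ab *
      f (Function.update (Function.update v (pos i) ab.1) (posSucc i) ab.2) := by
  have hne := pos_ne i
  simp only [Matrix.mulVec, dotProduct, localMat, Matrix.of_apply, ite_mul, zero_mul]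
  rw [← Finset.sum_filter]
  refine Finset.sum_bij' (fun w _ => (w (pos i), w (posSucc i)))
    (fun ab _ => Function.update (Function.update v (pos i) ab.1) (posSucc i) ab.2)
    (by simp) ?_ ?_ ?_ ?_
  · intro ab _
    simp only [Finset.mem_filter, Finset.mem_univ, true_and]
    intro j h1 h2
    simp [Function.update_of_ne, h1, h2]
  · intro w hw
    simp only [Finset.mem_filter, Finset.mem_univ, true_and] at hw
    funext j
    by_cases h2 : j = posSucc i
    · subst h2; simp
    by_cases h1 : j = pos i
    · subst h1; simp [hne]
    simp [h1, h2, hw j h1 h2]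
  · intro ab _
    simp [hne]
  · intro w hw
    simp only [Finset.mem_filter, Finset.mem_univ, true_and] at hw
    congr 2
    funext j
    by_cases h2 : j = posSucc i
    · subst h2; simp
    by_cases h1 : j = pos i
    · subst h1; simp [hne]
    simp [h1, h2, hw j h1 h2]

/-- The action of `localMat (matM t) i` on functions, letter by letter. -/
theorem matM_mulVec {n : ℕ} (t : k) (i : Fin (n - 1)) (f : Word n → k) (v : Word n) :
    (localMat (matM t) i).mulVec f v =
      if v (pos i) = 0 then
        (if v (posSucc i) = 0 then f v
          else f (Function.update (Function.update v (pos i) 1) (posSucc i) 0))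
      else
        (if v (posSucc i) = 0 then (1 - t) * f v +
            t * f (Function.update (Function.update v (pos i) 0) (posSucc i) 1)
          else -t * f v) := by
  have h2 : ∀ x : Fin 2, x = 0 ∨ x = 1 := by decide
  have key : ∀ a b, v (pos i) = a → v (posSucc i) = b →
      Function.update (Function.update v (pos i) a) (posSucc i) b = v := by
    rintro a b rfl rfl; simp
  rw [localMat_mulVec, Fintype.sum_prod_type]
  simp only [Fin.sum_univ_two]
  rcases h2 (v (pos i)) with h | h <;> rcases h2 (v (posSucc i)) with h' | h' <;>
    have e := key _ _ h h' <;> rw [h, h'] <;> simp [matM, e, add_comm]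

theorem exists_update_three {n : ℕ} (v : Word n) {p q r : Fin n} (hpq : p ≠ q) (hpr : p ≠ r)
    (hqr : q ≠ r) : ∃ (u : Fin 2 → Fin 2 → Fin 2 → Word n) (a b c : Fin 2), v = u a b c ∧
      (∀ a b c, u a b c p = a) ∧ (∀ a b c, u a b c q = b) ∧ (∀ a b c, u a b c r = c) ∧
      (∀ a b c x, Function.update (u a b c) p x = u x b c) ∧
      (∀ a b c x, Function.update (u a b c) q x = u a x c) ∧
      (∀ a b c x, Function.update (u a b c) r x = u a b x) := by
  refine ⟨fun a b c => Function.update (Function.update (Function.update v p a) q b) r c,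
    v p, v q, v r, by simp, by simp [hpq, hpr], by simp [hqr], by simp, ?_, ?_, by simp⟩
  · intro a b c x
    rw [Function.update_comm hpr.symm, Function.update_comm hpq.symm, Function.update_idem]
  · intro a b c x
    rw [Function.update_comm hqr.symm, Function.update_idem]

theorem exists_update_four {n : ℕ} (v : Word n) {p q r s : Fin n} (hpq : p ≠ q) (hpr : p ≠ r)
    (hps : p ≠ s) (hqr : q ≠ r) (hqs : q ≠ s) (hrs : r ≠ s) :
    ∃ (u : Fin 2 → Fin 2 → Fin 2 → Fin 2 → Word n) (a b c d : Fin 2), v = u a b c d ∧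
      (∀ a b c d, u a b c d p = a) ∧ (∀ a b c d, u a b c d q = b) ∧
      (∀ a b c d, u a b c d r = c) ∧ (∀ a b c d, u a b c d s = d) ∧
      (∀ a b c d x, Function.update (u a b c d) p x = u x b c d) ∧
      (∀ a b c d x, Function.update (u a b c d) q x = u a x c d) ∧
      (∀ a b c d x, Function.update (u a b c d) r x = u a b x d) ∧
      (∀ a b c d x, Function.update (u a b c d) s x = u a b c x) := by
  refine ⟨fun a b c d => Function.update (Function.update (Function.update
      (Function.update v p a) q b) r c) s d,
    v p, v q, v r, v s, by simp, by simp [hpq, hpr, hps], by simp [hqr, hqs], by simp [hrs],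
    by simp, ?_, ?_, ?_, by simp⟩
  · intro a b c d x
    rw [Function.update_comm hps.symm, Function.update_comm hpr.symm,
      Function.update_comm hpq.symm, Function.update_idem]
  · intro a b c d x
    rw [Function.update_comm hqs.symm, Function.update_comm hqr.symm, Function.update_idem]
  · intro a b c d x
    rw [Function.update_comm hrs.symm, Function.update_idem]

theorem matrix_ext_mulVec {m : Type*} [Fintype m] [DecidableEq m] {A B : Matrix m m k}
    (h : ∀ f v, A.mulVec f v = B.mulVec f v) : A = B :=
  Matrix.toLin'.injective (LinearMap.ext fun f => funext fun v => by
    simpa only [Matrix.toLin'_apply] using h f v)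

theorem localMat_sq {n : ℕ} (t : k) (i : Fin (n - 1)) :
    localMat (matM t) i * localMat (matM t) i =
      (1 - t) • localMat (matM t) i + t • (1 : Matrix (Word n) (Word n) k) := by
  refine matrix_ext_mulVec fun f v => ?_
  have hne := pos_ne i
  rw [← Matrix.mulVec_mulVec, Matrix.add_mulVec, Matrix.smul_mulVec, Matrix.smul_mulVec,
    Matrix.one_mulVec]
  simp only [Pi.add_apply, Pi.smul_apply, smul_eq_mul, matM_mulVec]
  have h2 : ∀ x : Fin 2, x = 0 ∨ x = 1 := by decide
  have key : ∀ a b, v (pos i) = a → v (posSucc i) = b →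
      Function.update (Function.update v (pos i) a) (posSucc i) b = v := by
    rintro a b rfl rfl; simp
  have e1 : ∀ a b c d, Function.update (Function.update (Function.update (Function.update v (pos i) a)
      (posSucc i) b) (pos i) c) (posSucc i) d =
      Function.update (Function.update v (pos i) c) (posSucc i) d := by
    intro a b c d
    rw [Function.update_comm hne.symm, Function.update_idem, Function.update_idem]
  rcases h2 (v (pos i)) with h | h <;> rcases h2 (v (posSucc i)) with h' | h' <;>
    have e := key _ _ h h' <;> simp [h, h', e, e1, hne] <;> ring

theorem localMat_braid {n : ℕ} (t s r : k)
    (hyp : (t = s ∧ s = r) ∨ (t = 1 ∧ s = 1) ∨ (t = 1 ∧ s = r))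
    (i j : Fin (n - 1)) (h : i.val + 1 = j.val) :
    localMat (matM t) i * localMat (matM s) j * localMat (matM r) i =
      localMat (matM r) j * localMat (matM s) i * localMat (matM t) j := by
  have hj : pos j = posSucc i := Fin.ext (by simp [pos, posSucc, h])
  have d1 : pos i ≠ posSucc i := pos_ne i
  have d2 : pos i ≠ posSucc j := fun e => by
    have := congrArg Fin.val e; simp only [pos, posSucc] at this; omega
  have d3 : posSucc i ≠ posSucc j := hj ▸ pos_ne j
  refine matrix_ext_mulVec fun f v => ?_
  obtain ⟨u, a, b, c, rfl, hp, hq, hr, up, uq, ur⟩ := exists_update_three v d1 d2 d3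
  simp only [← Matrix.mulVec_mulVec, matM_mulVec, hj, hp, hq, hr, up, uq, ur]
  rcases hyp with ⟨rfl, rfl⟩ | ⟨rfl, rfl⟩ | ⟨rfl, rfl⟩ <;>
    fin_cases a <;> fin_cases b <;> fin_cases c <;> simp <;> ring

theorem localMat_far {n : ℕ} (t s : k) (i j : Fin (n - 1)) (h : i.val + 1 < j.val) :
    localMat (matM t) i * localMat (matM s) j = localMat (matM s) j * localMat (matM t) i := by
  have d1 : pos i ≠ posSucc i := pos_ne i
  have d2 : pos i ≠ pos j := fun e => by
    have := congrArg Fin.val e; simp only [pos] at this; omega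
  have d3 : pos i ≠ posSucc j := fun e => by
    have := congrArg Fin.val e; simp only [pos, posSucc] at this; omega
  have d4 : posSucc i ≠ pos j := fun e => by
    have := congrArg Fin.val e; simp only [pos, posSucc] at this; omega
  have d5 : posSucc i ≠ posSucc j := fun e => by
    have := congrArg Fin.val e; simp only [posSucc] at this; omega
  have d6 : pos j ≠ posSucc j := pos_ne j
  refine matrix_ext_mulVec fun f v => ?_
  obtain ⟨u, a, b, c, d, rfl, hp, hq, hr, hs, up, uq, ur, us⟩ :=
    exists_update_four v d1 d2 d3 d4 d5 d6
  simp only [← Matrix.mulVec_mulVec, matM_mulVec, hp, hq, hr, hs, up, uq, ur, us]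
  fin_cases a <;> fin_cases b <;> fin_cases c <;> fin_cases d <;> simp <;> ring

/-- The invertible matrix `F_n(σ_i) = 1 ⊗ ⋯ ⊗ M'_t ⊗ ⋯ ⊗ 1`, for `t` invertible. -/
def sigUnit (t : kˣ) {n : ℕ} (i : Fin (n - 1)) : (Matrix (Word n) (Word n) k)ˣ where
  val := localMat (matM (t : k)) i
  inv := (t : k)⁻¹ • (localMat (matM (t : k)) i - (1 - (t : k)) • 1)
  val_inv := by
    rw [Matrix.mul_smul, mul_sub, localMat_sq, Matrix.mul_smul, mul_one, add_sub_cancel_left,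
      smul_smul, inv_mul_cancel₀ t.ne_zero, one_smul]
  inv_val := by
    rw [Matrix.smul_mul, sub_mul, localMat_sq, Matrix.smul_mul, one_mul, add_sub_cancel_left,
      smul_smul, inv_mul_cancel₀ t.ne_zero, one_smul]

/-- The images of the letters: `σ_i ↦ 1 ⊗ ⋯ ⊗ M'_t ⊗ ⋯ ⊗ 1`, `ρ_i ↦ 1 ⊗ ⋯ ⊗ M'_1 ⊗ ⋯ ⊗ 1`. -/
def genUnit (t : kˣ) {n : ℕ} : Gen n → (Matrix (Word n) (Word n) k)ˣ
  | Gen.sig i => sigUnit t i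
  | Gen.rho i => sigUnit 1 i

theorem genUnit_rel (t : kˣ) {n : ℕ} {l r : FreeGroup (Gen n)} (h : Rel n l r) :
    FreeGroup.lift (genUnit t) l = FreeGroup.lift (genUnit t) r := by
  cases h <;> simp only [freeSig, freeRho, map_mul, map_one, FreeGroup.lift_apply_of, genUnit] <;>
    apply Units.ext <;> simp only [Units.val_mul, sigUnit, Units.val_one]
  · exact localMat_braid _ _ _ (by simp) _ _ (by assumption)
  · exact localMat_far _ _ _ _ (by assumption)
  · exact localMat_braid _ _ _ (by simp) _ _ (by assumption)
  · exact localMat_far _ _ _ _ (by assumption)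
  · simp [localMat_sq]
  · rename_i h
    rcases h with h | h
    · exact localMat_far _ _ _ _ h
    · exact (localMat_far _ _ _ _ h).symm
  · exact localMat_braid _ _ _ (by simp) _ _ (by assumption)
  · exact localMat_braid _ _ _ (by simp) _ _ (by assumption)

/-- The representation `F_n` of the group `LB_n` on `(k²)^{⊗ n}`. -/
def repGroup (t : kˣ) (n : ℕ) : LB n →* (Matrix (Word n) (Word n) k)ˣ :=
  PresentedGroup.toGroup (f := genUnit t) (by
    rintro x ⟨l, r, h, rfl⟩
    rw [map_mul, map_inv, genUnit_rel t h, mul_inv_cancel])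

/-- The representation `F_n`, extended linearly to the group algebra `k LB_n`. -/
noncomputable def rep (t : kˣ) (n : ℕ) :
    MonoidAlgebra k (LB n) →ₐ[k] Matrix (Word n) (Word n) k :=
  MonoidAlgebra.lift k (Matrix (Word n) (Word n) k) (LB n)
    ((Units.coeHom (Matrix (Word n) (Word n) k)).comp (repGroup t n))

/-! ### The algebra `SP_n` -/

/-- The algebra `SP_n = k LB_n / Ann F_n`. The annihilator of a representation is the
kernel of the action map of the group algebra. -/
abbrev SP (t : kˣ) (n : ℕ) : Type _ := MonoidAlgebra k (LB n) ⧸ RingHom.ker (rep t n)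

/-- The class in `SP_n` of a group element. -/
noncomputable def SP.ofLB (t : kˣ) {n : ℕ} (g : LB n) : SP t n :=
  Ideal.Quotient.mk _ (MonoidAlgebra.of k (LB n) g)

/-- The element `χ_i = (σ_i - ρ_i) / (1 - t)` of `SP_n`. -/
noncomputable def SP.chi (t : kˣ) {n : ℕ} (i : Fin (n - 1)) : SP t n :=
  (1 - (t : k))⁻¹ • (SP.ofLB t (sig i) - SP.ofLB t (rho i))

/-- The element `χ_1` of `SP_{n+1}`, where `n + 1 ≥ 2`. -/
noncomputable def SP.chiOne (t : kˣ) {n : ℕ} (hn : 1 ≤ n) : SP t (n + 1) :=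
  SP.chi t (⟨0, hn⟩ : Fin (n + 1 - 1))

/-- The algebra map `A ↦ 1 ⊗ A` on matrices, with the new tensor factor on the left. -/
def oneTensor (k : Type*) [Field k] (n : ℕ) :
    Matrix (Word n) (Word n) k →ₐ[k] Matrix (Word (n + 1)) (Word (n + 1)) k where
  toFun A := Matrix.of fun v w => if v 0 = w 0 then A (Fin.tail v) (Fin.tail w) else 0
  map_one' := by
    ext v w
    simp only [Matrix.of_apply, Matrix.one_apply]
    have h : v = w ↔ v 0 = w 0 ∧ Fin.tail v = Fin.tail w := by
      conv_lhs => rw [← Fin.cons_self_tail v, ← Fin.cons_self_tail w, Fin.cons_inj]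
    split_ifs <;> tauto
  map_mul' A B := by
    ext v w
    simp only [Matrix.of_apply, Matrix.mul_apply]
    rw [← (Fin.consEquiv fun _ : Fin (n + 1) => Fin 2).sum_comp, Fintype.sum_prod_type,
      Finset.sum_eq_single (v 0)]
    · by_cases h : v 0 = w 0 <;> simp [Fin.consEquiv, h]
    · intro a _ ha
      simp [Fin.consEquiv, ha.symm]
    · simp
  map_zero' := by ext v w; simp
  map_add' A B := by ext v w; by_cases h : v 0 = w 0 <;> simp [h]
  commutes' c := by
    ext v w
    simp only [Matrix.of_apply, Matrix.algebraMap_matrix_apply]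
    have h : v = w ↔ v 0 = w 0 ∧ Fin.tail v = Fin.tail w := by
      conv_lhs => rw [← Fin.cons_self_tail v, ← Fin.cons_self_tail w, Fin.cons_inj]
    split_ifs <;> tauto

theorem oneTensor_localMat {n : ℕ} (M : Matrix (Fin 2 × Fin 2) (Fin 2 × Fin 2) k)
    (i : Fin (n - 1)) : oneTensor k n (localMat M i) = localMat M (shiftIdx i) := by
  have e1 : pos (shiftIdx i) = (pos i).succ := rfl
  have e2 : posSucc (shiftIdx i) = (posSucc i).succ := rfl
  ext v w
  change (if v 0 = w 0 then (localMat M i) (Fin.tail v) (Fin.tail w) else 0) = _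
  simp only [localMat, Matrix.of_apply, e1, e2, Fin.forall_fin_succ, Fin.tail,
    ne_eq, Fin.succ_inj, (Fin.succ_ne_zero _).symm, not_false_eq_true, true_implies]
  by_cases h : v 0 = w 0
  · simp only [h, true_and, if_true]
    congr
  · simp [h]

theorem rep_shift (t : kˣ) (n : ℕ) (x : MonoidAlgebra k (LB n)) :
    rep t (n + 1) (MonoidAlgebra.mapDomainAlgHom k k (shiftLB n) x) =
      oneTensor k n (rep t n x) := by
  have key : (repGroup t (n + 1)).comp (shiftLB n) =
      (Units.map (oneTensor k n : _ →* _)).comp (repGroup t n) := by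
    refine PresentedGroup.ext fun g => ?_
    have h1 : shiftLB n (PresentedGroup.of g) = PresentedGroup.of (shiftGen g) := by
      change PresentedGroup.mk _ (FreeGroup.map shiftGen (FreeGroup.of g)) = _
      rw [FreeGroup.map.of]
      rfl
    rw [MonoidHom.comp_apply, MonoidHom.comp_apply, h1, repGroup, repGroup,
      PresentedGroup.toGroup.of, PresentedGroup.toGroup.of]
    apply Units.ext
    cases g <;> exact (oneTensor_localMat _ _).symm
  have : (rep t (n + 1)).comp (MonoidAlgebra.mapDomainAlgHom k k (shiftLB n)) =
      (oneTensor k n).comp (rep t n) := by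
    refine MonoidAlgebra.algHom_ext (fun g => ?_) (Subsingleton.elim _ _)
    have := congrArg Units.val (DFunLike.congr_fun key g)
    simpa [rep] using this
  exact DFunLike.congr_fun this x

/-- Translation `w ↦ w^{(1)}` as an algebra map `SP_n → SP_{n+1}`, induced by the translation
of loop braids. -/
noncomputable def SP.translate (t : kˣ) (n : ℕ) : SP t n →ₐ[k] SP t (n + 1) :=
  Ideal.quotientMapₐ (RingHom.ker (rep t (n + 1)))
    (MonoidAlgebra.mapDomainAlgHom k k (shiftLB n)) (by
      intro x hx
      have hx' : rep t n x = 0 := hx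
      change rep t (n + 1) (MonoidAlgebra.mapDomainAlgHom k k (shiftLB n) x) = 0
      rw [rep_shift, hx', map_zero])

/-- The corner `eAe` of a `k`-algebra `A` at an idempotent `e`, whose unit is `e`, is a
`k`-algebra with the scalar multiplication of `A`. -/
noncomputable instance cornerAlgebra {A : Type*} [Ring A] [Algebra k A] {e : A}
    (he : IsIdempotentElem e) : Algebra k he.Corner :=
  letI : SMul k he.Corner := ⟨fun c x => ⟨c • x.1, by
    obtain ⟨a, ha⟩ := x.2
    exact ⟨c • a, by simp only [← ha, mul_smul_comm, smul_mul_assoc]⟩⟩⟩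
  letI : Module k he.Corner :=
    { one_smul := fun x => Subtype.ext (one_smul k x.1)
      mul_smul := fun a b x => Subtype.ext (mul_smul a b x.1)
      smul_zero := fun a => Subtype.ext (smul_zero a)
      smul_add := fun a x y => Subtype.ext (smul_add a x.1 y.1)
      add_smul := fun a b x => Subtype.ext (add_smul a b x.1)
      zero_smul := fun x => Subtype.ext (zero_smul k x.1) }
  Algebra.ofModule (fun a x y => Subtype.ext (smul_mul_assoc a x.1 y.1))
    (fun a x y => Subtype.ext (mul_smul_comm a x.1 y.1))

end LoopBraid

/-!
The words in `e_1, e_2` label the monomials of the exterior algebra on `x_0, …, x_{n-1}`: a word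
stands for the increasing product of the `x_i` over the positions of the letter `e_2`. With this
identification `M'_s` at neighbouring positions `i, i + 1` becomes the map that a rank one
perturbation of the identity of `k^n` induces on the exterior algebra, namely
`1 - (s x_i - x_{i+1}) ∧ ι` with `ι` the contraction with `x_i^* - x_{i+1}^*`
(`localMat_matM`). In particular `χ_i` acts as `x_i ∧ ι`.

All the linear forms that occur vanish on `x_0 + ⋯ + x_{n-1}`. When `t ≠ 1`, commutators of the
operators that occur give every `x ∧ ι_φ` with `φ` of sum zero, so the image of `F_n` is the
algebra generated by these operators (`rep_range_eq_dyadAlg`). Being a quotient by an annihilator,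
`SP_n` is isomorphic to it.

Write `χ = x_0 ∧ ι_φ` for the image of `χ_1` in this model for `n + 1` strands, and `B` for the
algebra acting on the last `n` factors. The image of `χ` is `e_2 ⊗ (k²)^{⊗ n}`, which `B` preserves
and on which `B` acts faithfully, so that `w ↦ χ w χ = w χ` is multiplicative and injective on `B`.
For surjectivity, the canonical anticommutation relations show that the span `N` of the operators
`b (x ∧ ι_φ)`, with `b` in `B` and `x` any vector, is a left ideal (`dyadAlg_mul_mem`). As `N`
contains `χ`, it contains `a χ` for every `a`; and `χ N ⊆ B χ` (`dyad_single_mul_leftIdeal`),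
because moving `χ` to the right past `B` leaves its vector `x_0` in place.

In the quotient by the ideal of `χ_1` the generators `σ_1` and `ρ_1` agree. The relations
`ρ_1² = 1` and `σ_1² = (1 - t) σ_1 + t` then make both equal to `1`, and the braid relations pass
this on to all the other generators, so the quotient is spanned by `1`. It is not zero, since the
action on the line of `e_1 ⊗ ⋯ ⊗ e_1` kills `χ_1`.
-/

namespace LoopBraid

open Submodule

variable {k : Type*} [Field k]

/-! ### Fermionic creation and annihilation operators -/

/-- The algebra map `P ↦ P ⊗ 1 ⊗ ⋯ ⊗ 1`, with `P` acting on the leftmost tensor factor. -/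
def headTensor (k : Type*) [Field k] (n : ℕ) :
    Matrix (Fin 2) (Fin 2) k →ₐ[k] Matrix (Word (n + 1)) (Word (n + 1)) k where
  toFun P := Matrix.of fun v w => if Fin.tail v = Fin.tail w then P (v 0) (w 0) else 0
  map_one' := by
    ext v w
    simp only [Matrix.of_apply, Matrix.one_apply]
    have h : v = w ↔ v 0 = w 0 ∧ Fin.tail v = Fin.tail w := by
      conv_lhs => rw [← Fin.cons_self_tail v, ← Fin.cons_self_tail w, Fin.cons_inj]
    split_ifs <;> tauto
  map_mul' P Q := by
    ext v w
    simp only [Matrix.of_apply, Matrix.mul_apply]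
    rw [← (Fin.consEquiv fun _ : Fin (n + 1) => Fin 2).sum_comp, Fintype.sum_prod_type_right,
      Finset.sum_eq_single (Fin.tail v)]
    · by_cases h : Fin.tail v = Fin.tail w <;> simp [Fin.consEquiv, h]
    · intro a _ ha
      simp [Fin.consEquiv, ha.symm]
    · simp
  map_zero' := by ext v w; simp
  map_add' P Q := by ext v w; by_cases h : Fin.tail v = Fin.tail w <;> simp [h]
  commutes' c := by
    ext v w
    simp only [Matrix.of_apply, Matrix.algebraMap_matrix_apply]
    have h : v = w ↔ v 0 = w 0 ∧ Fin.tail v = Fin.tail w := by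
      conv_lhs => rw [← Fin.cons_self_tail v, ← Fin.cons_self_tail w, Fin.cons_inj]
    split_ifs <;> tauto

theorem headTensor_mulVec {n : ℕ} (P : Matrix (Fin 2) (Fin 2) k) (f : Word (n + 1) → k)
    (v : Word (n + 1)) :
    (headTensor k n P).mulVec f v = ∑ a, P (v 0) a * f (Fin.cons a (Fin.tail v)) := by
  simp only [headTensor, Matrix.mulVec, dotProduct, AlgHom.coe_mk, RingHom.coe_mk, MonoidHom.coe_mk,
    OneHom.coe_mk, Matrix.of_apply]
  rw [← (Fin.consEquiv fun _ : Fin (n + 1) => Fin 2).sum_comp, Fintype.sum_prod_type_right,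
    Finset.sum_eq_single (Fin.tail v)]
  · simp [Fin.consEquiv]
  · intro a _ ha
    simp [Fin.consEquiv, ha.symm]
  · simp

theorem oneTensor_mulVec {n : ℕ} (A : Matrix (Word n) (Word n) k) (f : Word (n + 1) → k)
    (v : Word (n + 1)) :
    (oneTensor k n A).mulVec f v = A.mulVec (fun w => f (Fin.cons (v 0) w)) (Fin.tail v) := by
  simp only [oneTensor, Matrix.mulVec, dotProduct, AlgHom.coe_mk, RingHom.coe_mk, MonoidHom.coe_mk,
    OneHom.coe_mk, Matrix.of_apply]
  rw [← (Fin.consEquiv fun _ : Fin (n + 1) => Fin 2).sum_comp, Fintype.sum_prod_type,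
    Finset.sum_eq_single (v 0)]
  · simp [Fin.consEquiv]
  · intro a _ ha
    simp [Fin.consEquiv, ha.symm]
  · simp

theorem headTensor_commute_oneTensor {n : ℕ} (P : Matrix (Fin 2) (Fin 2) k)
    (A : Matrix (Word n) (Word n) k) :
    headTensor k n P * oneTensor k n A = oneTensor k n A * headTensor k n P := by
  refine matrix_ext_mulVec fun f v => ?_
  simp only [← Matrix.mulVec_mulVec, headTensor_mulVec, oneTensor_mulVec]
  simp only [Fin.cons_zero, Fin.tail_cons, Matrix.mulVec, dotProduct, Fin.sum_univ_two,
    mul_add, Finset.mul_sum, Finset.sum_add_distrib]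
  congr 1 <;> exact Finset.sum_congr rfl fun _ _ => by ring

/-- The operator raising `e_1` to `e_2` on `k²`. -/
def raise (k : Type*) [Field k] : Matrix (Fin 2) (Fin 2) k := !![0, 0; 1, 0]

/-- The operator lowering `e_2` to `e_1` on `k²`. -/
def lower (k : Type*) [Field k] : Matrix (Fin 2) (Fin 2) k := !![0, 1; 0, 0]

/-- The parity operator on `k²`, for which `e_1` is even and `e_2` is odd. -/
def parity (k : Type*) [Field k] : Matrix (Fin 2) (Fin 2) k := !![1, 0; 0, -1]

/-- The creation operators. Under the identification of `(k²)^{⊗ n}` with the exterior algebra on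
`x_0, …, x_{n-1}` that sends a word to the increasing product of the `x_i` over the positions of
the letter `e_2`, the operator `cre k i` is left multiplication by `x_i`. -/
def cre (k : Type*) [Field k] : {n : ℕ} → Fin n → Matrix (Word n) (Word n) k
  | 0 => fun i => i.elim0
  | n + 1 => Fin.cases (headTensor k n (raise k))
      fun i => headTensor k n (parity k) * oneTensor k n (cre k i)

/-- The annihilation operators: on the exterior algebra on `x_0, …, x_{n-1}`, the operator
`ann k i` is contraction with the `i`-th coordinate form. -/
def ann (k : Type*) [Field k] : {n : ℕ} → Fin n → Matrix (Word n) (Word n) k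
  | 0 => fun i => i.elim0
  | n + 1 => Fin.cases (headTensor k n (lower k))
      fun i => headTensor k n (parity k) * oneTensor k n (ann k i)

theorem cre_zero (n : ℕ) : cre k (0 : Fin (n + 1)) = headTensor k n (raise k) := rfl

theorem cre_succ {n : ℕ} (i : Fin n) :
    cre k i.succ = headTensor k n (parity k) * oneTensor k n (cre k i) := rfl

theorem ann_zero (n : ℕ) : ann k (0 : Fin (n + 1)) = headTensor k n (lower k) := rfl

theorem ann_succ {n : ℕ} (i : Fin n) :
    ann k i.succ = headTensor k n (parity k) * oneTensor k n (ann k i) := rfl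

theorem parity_mul_parity : parity k * parity k = 1 := by
  ext i j; fin_cases i <;> fin_cases j <;> simp [parity]

theorem headTensor_parity_mul {n : ℕ} (A B : Matrix (Word n) (Word n) k) :
    (headTensor k n (parity k) * oneTensor k n A) * (headTensor k n (parity k) * oneTensor k n B) =
      oneTensor k n (A * B) := by
  rw [mul_assoc, ← mul_assoc (oneTensor k n A), ← headTensor_commute_oneTensor, mul_assoc,
    ← mul_assoc, ← map_mul, parity_mul_parity, map_one, one_mul, map_mul]

/-- An odd operator on the first factor anticommutes with an operator carrying a parity sign. -/
theorem headTensor_anticomm {n : ℕ} {P : Matrix (Fin 2) (Fin 2) k}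
    (hP : P * parity k = -(parity k * P)) (A : Matrix (Word n) (Word n) k) :
    headTensor k n P * (headTensor k n (parity k) * oneTensor k n A) =
      -(headTensor k n (parity k) * oneTensor k n A * headTensor k n P) := by
  rw [← mul_assoc, ← map_mul, hP, map_neg, map_mul, mul_assoc, ← headTensor_commute_oneTensor,
    neg_mul, mul_assoc]

theorem raise_mul_parity : raise k * parity k = -(parity k * raise k) := by
  ext i j; fin_cases i <;> fin_cases j <;> simp [parity, raise]

theorem lower_mul_parity : lower k * parity k = -(parity k * lower k) := by
  ext i j; fin_cases i <;> fin_cases j <;> simp [parity, lower]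

theorem raise_mul_raise : raise k * raise k = 0 := by
  ext i j; fin_cases i <;> fin_cases j <;> simp [raise]

theorem lower_mul_lower : lower k * lower k = 0 := by
  ext i j; fin_cases i <;> fin_cases j <;> simp [lower]

theorem lower_mul_raise : lower k * raise k = 1 - raise k * lower k := by
  ext i j; fin_cases i <;> fin_cases j <;> simp [lower, raise]

theorem cre_mul_self {n : ℕ} (i : Fin n) : cre k i * cre k i = 0 := by
  induction n with
  | zero => exact i.elim0
  | succ n ih =>
    cases i using Fin.cases with
    | zero => rw [cre_zero, ← map_mul, raise_mul_raise, map_zero]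
    | succ i => rw [cre_succ, headTensor_parity_mul, ih, map_zero]

theorem ann_mul_self {n : ℕ} (i : Fin n) : ann k i * ann k i = 0 := by
  induction n with
  | zero => exact i.elim0
  | succ n ih =>
    cases i using Fin.cases with
    | zero => rw [ann_zero, ← map_mul, lower_mul_lower, map_zero]
    | succ i => rw [ann_succ, headTensor_parity_mul, ih, map_zero]

theorem cre_anticomm {n : ℕ} (i j : Fin n) : cre k i * cre k j = -(cre k j * cre k i) := by
  induction n with
  | zero => exact i.elim0
  | succ n ih =>
    cases i using Fin.cases with
    | zero =>
      cases j using Fin.cases with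
      | zero => rw [cre_mul_self, neg_zero]
      | succ j => exact headTensor_anticomm raise_mul_parity _
    | succ i =>
      cases j using Fin.cases with
      | zero => exact (neg_eq_iff_eq_neg.mpr (headTensor_anticomm raise_mul_parity _)).symm
      | succ j => simp only [cre_succ, headTensor_parity_mul]; rw [ih, map_neg]

theorem ann_anticomm {n : ℕ} (i j : Fin n) : ann k i * ann k j = -(ann k j * ann k i) := by
  induction n with
  | zero => exact i.elim0
  | succ n ih =>
    cases i using Fin.cases with
    | zero =>
      cases j using Fin.cases with
      | zero => rw [ann_mul_self, neg_zero]
      | succ j => exact headTensor_anticomm lower_mul_parity _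
    | succ i =>
      cases j using Fin.cases with
      | zero => exact (neg_eq_iff_eq_neg.mpr (headTensor_anticomm lower_mul_parity _)).symm
      | succ j => simp only [ann_succ, headTensor_parity_mul]; rw [ih, map_neg]

theorem ann_mul_cre {n : ℕ} (i j : Fin n) :
    ann k i * cre k j = (if i = j then 1 else 0) - cre k j * ann k i := by
  induction n with
  | zero => exact i.elim0
  | succ n ih =>
    cases i using Fin.cases with
    | zero =>
      cases j using Fin.cases with
      | zero => rw [cre_zero, ann_zero, ← map_mul, lower_mul_raise, map_sub, map_one, map_mul,
                  if_pos rfl]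
      | succ j =>
        rw [if_neg (Fin.succ_ne_zero j).symm, zero_sub]
        exact headTensor_anticomm lower_mul_parity _
    | succ i =>
      cases j using Fin.cases with
      | zero =>
        rw [if_neg (Fin.succ_ne_zero i), zero_sub]
        exact (neg_eq_iff_eq_neg.mpr (headTensor_anticomm raise_mul_parity _)).symm
      | succ j =>
        simp only [cre_succ, ann_succ, headTensor_parity_mul, Fin.succ_inj]
        rw [ih, map_sub, apply_ite (oneTensor k n), map_one, map_zero]

/-- `matM s` at neighbouring positions is the operator induced on the exterior algebra by a rank one
perturbation of the identity. -/
theorem localMat_matM (s : k) {n : ℕ} (i : Fin (n - 1)) :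
    localMat (matM s) i =
      1 - (s • cre k (pos i) - cre k (posSucc i)) * (ann k (pos i) - ann k (posSucc i)) := by
  induction n with
  | zero => exact i.elim0
  | succ n ih =>
    obtain ⟨_ | i, hi⟩ := i
    · obtain _ | n := n
      · exact absurd hi (by simp)
      have e0 : pos (⟨0, hi⟩ : Fin (n + 1 + 1 - 1)) = 0 := rfl
      have e1 : posSucc (⟨0, hi⟩ : Fin (n + 1 + 1 - 1)) = Fin.succ 0 := rfl
      refine matrix_ext_mulVec fun f v => ?_
      rw [matM_mulVec, e0, e1, cre_succ, ann_succ, cre_zero, ann_zero, cre_zero, ann_zero]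
      simp only [sub_mul, mul_sub, Matrix.sub_mulVec, Matrix.one_mulVec, Matrix.smul_mul,
        Matrix.smul_mulVec, ← Matrix.mulVec_mulVec, Pi.sub_apply, Pi.smul_apply, smul_eq_mul,
        headTensor_mulVec, oneTensor_mulVec, Fin.sum_univ_two]
      obtain ⟨a, v, rfl⟩ : ∃ a w, v = Fin.cons a w := ⟨v 0, Fin.tail v, (Fin.cons_self_tail v).symm⟩
      obtain ⟨b, v, rfl⟩ : ∃ a w, v = Fin.cons a w := ⟨v 0, Fin.tail v, (Fin.cons_self_tail v).symm⟩
      have hu : ∀ a b c : Fin 2, Function.update (Fin.cons a (Fin.cons b v) : Word (n + 1 + 1))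
          (Fin.succ 0) c = Fin.cons a (Fin.cons c v) := by
        intro a b c
        rw [← Fin.cons_update, Fin.update_cons_zero]
      simp only [Fin.update_cons_zero, hu]
      fin_cases a <;> fin_cases b <;> simp [raise, lower, parity]
      ring
    · have hi' : i < n - 1 := by omega
      have h := congrArg (oneTensor k n) (ih ⟨i, hi'⟩)
      rw [oneTensor_localMat] at h
      have e0 : pos (⟨i + 1, hi⟩ : Fin (n + 1 - 1)) = (pos ⟨i, hi'⟩).succ := rfl
      have e1 : posSucc (⟨i + 1, hi⟩ : Fin (n + 1 - 1)) = (posSucc ⟨i, hi'⟩).succ := rfl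
      refine h.trans ?_
      rw [e0, e1]
      simp only [cre_succ, ann_succ, sub_mul, mul_sub, Matrix.smul_mul, headTensor_parity_mul,
        map_sub, map_one, map_smul]

/-! ### The operators `x ∧ ι_φ` -/

/-- The operator `x ∧ ι_φ` on the exterior algebra: contraction with the linear form `φ`, followed
by multiplication by the vector `x`. -/
def dyad {n : ℕ} (x φ : Fin n → k) : Matrix (Word n) (Word n) k :=
  (∑ i, x i • cre k i) * ∑ i, φ i • ann k i

theorem sum_cre_mul_self {n : ℕ} (x : Fin n → k) :
    (∑ i, x i • cre k i) * (∑ i, x i • cre k i) = 0 := by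
  -- In characteristic two anticommutativity does not suffice; pair the terms off the diagonal.
  rw [Finset.sum_mul_sum, ← Finset.sum_product']
  refine Finset.sum_involution (fun p _ => (p.2, p.1)) ?_ ?_ (by simp) (by simp)
  · rintro ⟨i, j⟩ -
    simp only [Matrix.smul_mul, Matrix.mul_smul]
    rw [cre_anticomm j i, smul_neg, smul_neg, smul_comm, add_neg_cancel]
  · rintro ⟨i, j⟩ - h e
    obtain rfl : j = i := congrArg Prod.fst e
    simp [cre_mul_self] at h

theorem sum_ann_mul_self {n : ℕ} (x : Fin n → k) :
    (∑ i, x i • ann k i) * (∑ i, x i • ann k i) = 0 := by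
  rw [Finset.sum_mul_sum, ← Finset.sum_product']
  refine Finset.sum_involution (fun p _ => (p.2, p.1)) ?_ ?_ (by simp) (by simp)
  · rintro ⟨i, j⟩ -
    simp only [Matrix.smul_mul, Matrix.mul_smul]
    rw [ann_anticomm j i, smul_neg, smul_neg, smul_comm, add_neg_cancel]
  · rintro ⟨i, j⟩ - h e
    obtain rfl : j = i := congrArg Prod.fst e
    simp [ann_mul_self] at h

theorem sum_cre_anticomm {n : ℕ} (x y : Fin n → k) :
    (∑ i, x i • cre k i) * (∑ i, y i • cre k i) =
      -((∑ i, y i • cre k i) * (∑ i, x i • cre k i)) := by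
  rw [Finset.sum_mul_sum, Finset.sum_mul_sum, Finset.sum_comm, ← Finset.sum_neg_distrib]
  refine Finset.sum_congr rfl fun i _ => ?_
  rw [← Finset.sum_neg_distrib]
  refine Finset.sum_congr rfl fun j _ => ?_
  simp only [Matrix.smul_mul, Matrix.mul_smul]
  rw [cre_anticomm, smul_neg, smul_neg, smul_comm]

theorem sum_ann_anticomm {n : ℕ} (x y : Fin n → k) :
    (∑ i, x i • ann k i) * (∑ i, y i • ann k i) =
      -((∑ i, y i • ann k i) * (∑ i, x i • ann k i)) := by
  rw [Finset.sum_mul_sum, Finset.sum_mul_sum, Finset.sum_comm, ← Finset.sum_neg_distrib]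
  refine Finset.sum_congr rfl fun i _ => ?_
  rw [← Finset.sum_neg_distrib]
  refine Finset.sum_congr rfl fun j _ => ?_
  simp only [Matrix.smul_mul, Matrix.mul_smul]
  rw [ann_anticomm, smul_neg, smul_neg, smul_comm]

theorem sum_ann_mul_sum_cre {n : ℕ} (φ x : Fin n → k) :
    (∑ i, φ i • ann k i) * (∑ i, x i • cre k i) =
      (φ ⬝ᵥ x) • 1 - (∑ i, x i • cre k i) * (∑ i, φ i • ann k i) := by
  rw [Finset.sum_mul_sum, Finset.sum_mul_sum, Finset.sum_comm (s := Finset.univ (α := Fin n)),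
    dotProduct, Finset.sum_smul, ← Finset.sum_sub_distrib]
  refine Finset.sum_congr rfl fun j _ => ?_
  have e : (φ j * x j) • (1 : Matrix (Word n) (Word n) k) =
      ∑ i, if i = j then (φ i * x i) • 1 else 0 := by simp
  rw [e, ← Finset.sum_sub_distrib]
  refine Finset.sum_congr rfl fun i _ => ?_
  simp only [Matrix.smul_mul, Matrix.mul_smul]
  rw [ann_mul_cre, smul_sub, smul_sub, smul_comm (x j) _ (cre k j * ann k i)]
  split_ifs with h
  · rw [h, smul_smul, mul_comm]
  · simp

theorem dyad_add_left {n : ℕ} (x y φ : Fin n → k) : dyad (x + y) φ = dyad x φ + dyad y φ := by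
  simp only [dyad, Pi.add_apply, add_smul, Finset.sum_add_distrib, add_mul]

theorem dyad_add_right {n : ℕ} (x φ ψ : Fin n → k) : dyad x (φ + ψ) = dyad x φ + dyad x ψ := by
  simp only [dyad, Pi.add_apply, add_smul, Finset.sum_add_distrib, mul_add]

theorem dyad_smul_left {n : ℕ} (c : k) (x φ : Fin n → k) : dyad (c • x) φ = c • dyad x φ := by
  simp only [dyad, Pi.smul_apply, smul_eq_mul, mul_smul, ← Finset.smul_sum, Matrix.smul_mul]

theorem dyad_smul_right {n : ℕ} (c : k) (x φ : Fin n → k) : dyad x (c • φ) = c • dyad x φ := by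
  simp only [dyad, Pi.smul_apply, smul_eq_mul, mul_smul, ← Finset.smul_sum, Matrix.mul_smul]

theorem dyad_single_left {n : ℕ} (i : Fin n) (φ : Fin n → k) :
    dyad (Pi.single i 1) φ = cre k i * ∑ i, φ i • ann k i := by
  simp [dyad, Pi.single_apply]

/-- Contraction and multiplication satisfy the canonical anticommutation relations, so a product of
two operators `x ∧ ι_φ` is normally ordered up to a term of lower order. -/
theorem dyad_mul_dyad {n : ℕ} (x φ y ψ : Fin n → k) :
    dyad x φ * dyad y ψ = (φ ⬝ᵥ y) • dyad x ψ -
      (∑ i, x i • cre k i) * (∑ i, y i • cre k i) *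
        ((∑ i, φ i • ann k i) * (∑ i, ψ i • ann k i)) := by
  rw [dyad, dyad, mul_assoc, ← mul_assoc (∑ i, φ i • ann k i), sum_ann_mul_sum_cre, sub_mul,
    mul_sub, dyad, Matrix.smul_mul, Matrix.mul_smul, one_mul]
  simp only [mul_assoc]

theorem dyad_commutator {n : ℕ} (x φ y ψ : Fin n → k) :
    dyad x φ * dyad y ψ =
      (φ ⬝ᵥ y) • dyad x ψ - (ψ ⬝ᵥ x) • dyad y φ + dyad y ψ * dyad x φ := by
  rw [dyad_mul_dyad, dyad_mul_dyad y, sum_cre_anticomm x y, sum_ann_anticomm φ ψ, neg_mul_neg]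
  abel

theorem dyad_mul_dyad_same_right {n : ℕ} (x y φ : Fin n → k) :
    dyad x φ * dyad y φ = (φ ⬝ᵥ y) • dyad x φ := by
  rw [dyad_mul_dyad, sum_ann_mul_self, mul_zero, sub_zero]

theorem dyad_mul_dyad_same_left {n : ℕ} (x φ ψ : Fin n → k) :
    dyad x φ * dyad x ψ = (φ ⬝ᵥ x) • dyad x ψ := by
  rw [dyad_mul_dyad, sum_cre_mul_self, zero_mul, sub_zero]

theorem oneTensor_dyad {n : ℕ} (x φ : Fin n → k) :
    oneTensor k n (dyad x φ) = dyad (Fin.cons 0 x) (Fin.cons 0 φ) := by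
  simp only [dyad, Fin.sum_univ_succ, Fin.cons_zero, Fin.cons_succ, zero_smul, zero_add, cre_succ,
    ann_succ, ← Matrix.mul_smul, ← Finset.mul_sum, ← map_smul, ← map_sum, headTensor_parity_mul]

/-! ### The algebra generated by the operators `x ∧ ι_φ` with `φ` of sum zero -/

/-- The algebra generated by the operators `x ∧ ι_φ` for which `φ` vanishes on
`x_0 + ⋯ + x_{n-1}`. -/
def dyadAlg (k : Type*) [Field k] (n : ℕ) : Subalgebra k (Matrix (Word n) (Word n) k) :=
  Algebra.adjoin k {a | ∃ x φ : Fin n → k, ∑ i, φ i = 0 ∧ dyad x φ = a}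

theorem dyad_mem_dyadAlg {n : ℕ} (x : Fin n → k) {φ : Fin n → k} (hφ : ∑ i, φ i = 0) :
    dyad x φ ∈ dyadAlg k n := Algebra.subset_adjoin ⟨x, φ, hφ, rfl⟩

/-- The algebra `dyadAlg k n`, acting on the last `n` of `n + 1` tensor factors. -/
def tailAlg (k : Type*) [Field k] (n : ℕ) :
    Subalgebra k (Matrix (Word (n + 1)) (Word (n + 1)) k) := (dyadAlg k n).map (oneTensor k n)

theorem dyad_mem_tailAlg {n : ℕ} {x φ : Fin (n + 1) → k} (hx : x 0 = 0) (h : φ 0 = 0)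
    (hφ : ∑ i, φ i = 0) : dyad x φ ∈ tailAlg k n := by
  refine ⟨dyad (Fin.tail x) (Fin.tail φ), dyad_mem_dyadAlg _ ?_, ?_⟩
  · rwa [Fin.sum_univ_succ, h, zero_add] at hφ
  · change oneTensor k n _ = _
    rw [oneTensor_dyad, ← hx, Fin.cons_self_tail, hx, ← h, Fin.cons_self_tail]

theorem tailAlg_eq_adjoin (n : ℕ) : tailAlg k n = Algebra.adjoin k
    {a | ∃ z θ : Fin (n + 1) → k, θ 0 = 0 ∧ z 0 = 0 ∧ ∑ i, θ i = 0 ∧ dyad z θ = a} := by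
  apply le_antisymm
  · rw [tailAlg, dyadAlg, AlgHom.map_adjoin]
    apply Algebra.adjoin_mono
    rintro _ ⟨_, ⟨x, φ, h, rfl⟩, rfl⟩
    exact ⟨Fin.cons 0 x, Fin.cons 0 φ, rfl, rfl, by simpa [Fin.sum_univ_succ] using h,
      (oneTensor_dyad _ _).symm⟩
  · rw [Algebra.adjoin_le_iff]
    rintro _ ⟨z, θ, h0, h1, h, rfl⟩
    exact dyad_mem_tailAlg h1 h0 h

theorem mul_mem_toSubmodule_mul {A : Type*} [Ring A] [Algebra k A] (B : Subalgebra k A)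
    {P : Submodule k A} {b m : A} (hb : b ∈ B) (hm : m ∈ B.toSubmodule * P) :
    b * m ∈ B.toSubmodule * P := by
  induction hm using Submodule.mul_induction_on' with
  | mem_mul_mem c hc p hp =>
    rw [← mul_assoc]
    exact Submodule.mul_mem_mul (B.mul_mem hb hc) hp
  | add x _ y _ hx hy => rw [mul_add]; exact add_mem hx hy

theorem mem_toSubmodule_mul {A : Type*} [Ring A] [Algebra k A] (B : Subalgebra k A)
    {P : Submodule k A} {m : A} (hm : m ∈ P) : m ∈ B.toSubmodule * P := by
  rw [← one_mul m]
  exact Submodule.mul_mem_mul B.one_mem hm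

/-- The span of the operators `y ∧ ι_ψ` with `y ∈ T` and `ψ` of sum zero. -/
def dyadSpan {n : ℕ} (T : Submodule k (Fin n → k)) :
    Submodule k (Matrix (Word n) (Word n) k) :=
  span k {a | ∃ y ψ, y ∈ T ∧ ∑ i, ψ i = 0 ∧ dyad y ψ = a}

/-- Operators `y ∧ ι_ψ` can be moved to the right past the algebra of the last `n` tensor factors:
their commutators with its generators are again combinations of such operators. The condition `hT`
holds for `T = ⊤`, and for the line of `x_0`, where the coefficient `θ ⬝ᵥ x` vanishes. -/
theorem dyadSpan_mul_mem {n : ℕ} {T : Submodule k (Fin (n + 1) → k)}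
    (hT : ∀ x ∈ T, ∀ θ : Fin (n + 1) → k, θ 0 = 0 → ∀ z, (θ ⬝ᵥ x) • z ∈ T)
    {b m : Matrix (Word (n + 1)) (Word (n + 1)) k} (hb : b ∈ tailAlg k n)
    (hm : m ∈ (tailAlg k n).toSubmodule * dyadSpan T) :
    m * b ∈ (tailAlg k n).toSubmodule * dyadSpan T := by
  rw [tailAlg_eq_adjoin] at hb
  induction hb using Algebra.adjoin_induction generalizing m with
  | mem b hb =>
    obtain ⟨z, θ, h0, h1, h, rfl⟩ := hb
    induction hm using Submodule.mul_induction_on' with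
    | mem_mul_mem c hc p hp =>
      rw [mul_assoc]
      refine mul_mem_toSubmodule_mul _ hc ?_
      induction hp using Submodule.span_induction with
      | mem p hp =>
        obtain ⟨x, ψ, hx, hψ, rfl⟩ := hp
        rw [dyad_commutator, ← dyad_smul_left, ← dyad_smul_left]
        refine add_mem (sub_mem ?_ ?_) ?_
        · exact mem_toSubmodule_mul _ (subset_span ⟨_, _, T.smul_mem _ hx, h, rfl⟩)
        · exact mem_toSubmodule_mul _ (subset_span ⟨_, _, hT x hx θ h0 z, hψ, rfl⟩)
        · exact Submodule.mul_mem_mul (dyad_mem_tailAlg h1 h0 h) (subset_span ⟨_, _, hx, hψ, rfl⟩)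
      | zero => rw [zero_mul]; exact zero_mem _
      | add x y _ _ hx hy => rw [add_mul]; exact add_mem hx hy
      | smul c x _ hx => rw [Matrix.smul_mul]; exact Submodule.smul_mem _ _ hx
    | add x _ y _ hx hy => rw [add_mul]; exact add_mem hx hy
  | algebraMap r => rw [← Algebra.commutes, ← Algebra.smul_def]; exact Submodule.smul_mem _ _ hm
  | add x y _ _ hx hy => rw [mul_add]; exact add_mem (hx hm) (hy hm)
  | mul x y _ _ hx hy => rw [← mul_assoc]; exact hy (hx hm)

section Corner

variable {n : ℕ} {φ : Fin (n + 1) → k}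

/-- Products `(x_0 ∧ ι_ψ)(x ∧ ι_φ)` lie in the left multiples of `x_0 ∧ ι_φ`. -/
theorem dyad_single_mul_mem (h0 : φ 0 = 1) (hφ : ∑ i, φ i = 0) (x : Fin (n + 1) → k)
    {ψ : Fin (n + 1) → k} (hψ : ∑ i, ψ i = 0) :
    dyad (Pi.single 0 1) ψ * dyad x φ ∈
      (tailAlg k n).toSubmodule * span k {dyad (Pi.single 0 1) φ} := by
  have hmem := mem_toSubmodule_mul (tailAlg k n)
    (mem_span_singleton_self (R := k) (dyad (Pi.single 0 1) φ))
  -- Split off from `ψ` its multiple of `φ`; the rest vanishes on `x_0`.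
  set ψ' := ψ - ψ 0 • φ with hψ'
  have hψ'0 : ψ' 0 = 0 := by simp [hψ', h0]
  have hψ's : ∑ i, ψ' i = 0 := by
    simp [hψ', Finset.sum_sub_distrib, ← Finset.mul_sum, hψ, hφ]
  set x' := x - x 0 • (Pi.single 0 1 : Fin (n + 1) → k) with hx'
  have hx'0 : x' 0 = 0 := by simp [hx']
  have e1 : dyad (Pi.single 0 1) ψ = dyad (Pi.single 0 1) ψ' + ψ 0 • dyad (Pi.single 0 1) φ := by
    rw [← dyad_smul_right, ← dyad_add_right, sub_add_cancel]
  have e2 : dyad x ψ' = dyad x' ψ' + x 0 • dyad (Pi.single 0 1) ψ' := by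
    rw [← dyad_smul_left, ← dyad_add_left, sub_add_cancel]
  have e3 : dyad (Pi.single 0 1) ψ' * dyad x φ = (ψ' ⬝ᵥ x) • dyad (Pi.single 0 1) φ
      - dyad x' ψ' * dyad (Pi.single 0 1) φ := by
    have h1 : dyad x' ψ' * dyad (Pi.single 0 1) φ = dyad x ψ' * dyad (Pi.single 0 1) φ := by
      rw [e2, add_mul, Matrix.smul_mul, dyad_mul_dyad_same_left]
      simp [hψ'0]
    rw [h1, dyad_mul_dyad, dyad_mul_dyad x, sum_cre_anticomm x]
    simp [hψ'0]
  rw [e1, add_mul, e3, Matrix.smul_mul, dyad_mul_dyad_same_right, smul_smul]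
  refine add_mem (sub_mem (Submodule.smul_mem _ _ hmem) ?_) (Submodule.smul_mem _ _ hmem)
  exact Submodule.mul_mem_mul (dyad_mem_tailAlg hx'0 hψ'0 hψ's) (mem_span_singleton_self _)

/-- Products `(y ∧ ι_ψ)(x ∧ ι_φ)` lie in the left span of the operators `x ∧ ι_φ`. -/
theorem dyad_mul_mem (h0 : φ 0 = 1) (hφ : ∑ i, φ i = 0) (x y : Fin (n + 1) → k)
    {ψ : Fin (n + 1) → k} (hψ : ∑ i, ψ i = 0) :
    dyad y ψ * dyad x φ ∈
      (tailAlg k n).toSubmodule * span k (Set.range fun x => dyad x φ) := by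
  -- Split off from `ψ` its multiple of `φ`; the rest vanishes on `x_0`.
  set ψ' := ψ - ψ 0 • φ with hψ'
  have hψ'0 : ψ' 0 = 0 := by simp [hψ', h0]
  have hψ's : ∑ i, ψ' i = 0 := by
    simp [hψ', Finset.sum_sub_distrib, ← Finset.mul_sum, hψ, hφ]
  set y' := y - y 0 • (Pi.single 0 1 : Fin (n + 1) → k) with hy'
  have hy'0 : y' 0 = 0 := by simp [hy']
  have e1 : dyad y ψ = dyad y' ψ' + ψ 0 • dyad y' φ + y 0 • dyad (Pi.single 0 1) ψ := by
    rw [← dyad_smul_right, ← dyad_add_right, sub_add_cancel, ← dyad_smul_left, ← dyad_add_left,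
      sub_add_cancel]
  rw [e1, add_mul, add_mul, Matrix.smul_mul, Matrix.smul_mul, dyad_mul_dyad_same_right]
  refine add_mem (add_mem ?_ ?_) ?_
  · exact Submodule.mul_mem_mul (dyad_mem_tailAlg hy'0 hψ'0 hψ's) (subset_span ⟨x, rfl⟩)
  · exact Submodule.smul_mem _ _ (Submodule.smul_mem _ _
      (mem_toSubmodule_mul _ (subset_span ⟨y', rfl⟩)))
  · have h : span k {dyad (Pi.single 0 1) φ} ≤ span k (Set.range fun x => dyad x φ) :=
      span_mono (Set.singleton_subset_iff.2 ⟨_, rfl⟩)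
    exact Submodule.smul_mem _ _ ((mul_le_mul' le_rfl h :
      (tailAlg k n).toSubmodule * _ ≤ _) (dyad_single_mul_mem h0 hφ x hψ))

/-- The left span of the operators `x ∧ ι_φ` over the algebra of the last `n` factors is a left
ideal of the whole algebra. -/
theorem dyadAlg_mul_mem (h0 : φ 0 = 1) (hφ : ∑ i, φ i = 0)
    {a m : Matrix (Word (n + 1)) (Word (n + 1)) k} (ha : a ∈ dyadAlg k (n + 1))
    (hm : m ∈ (tailAlg k n).toSubmodule * span k (Set.range fun x => dyad x φ)) :
    a * m ∈ (tailAlg k n).toSubmodule * span k (Set.range fun x => dyad x φ) := by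
  induction ha using Algebra.adjoin_induction generalizing m with
  | mem a ha =>
    obtain ⟨y, ψ, hψ, rfl⟩ := ha
    induction hm using Submodule.mul_induction_on' with
    | mem_mul_mem b hb p hp =>
      rw [← mul_assoc]
      have h : dyad y ψ * b ∈ (tailAlg k n).toSubmodule * dyadSpan ⊤ :=
        dyadSpan_mul_mem (fun _ _ _ _ _ => mem_top) hb
          (mem_toSubmodule_mul _ (subset_span ⟨y, ψ, mem_top, hψ, rfl⟩))
      generalize dyad y ψ * b = d at h
      induction h using Submodule.mul_induction_on' with
      | mem_mul_mem c hc q hq =>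
        rw [mul_assoc]
        refine mul_mem_toSubmodule_mul _ hc ?_
        induction hp using Submodule.span_induction with
        | mem p hp =>
          obtain ⟨x, rfl⟩ := hp
          induction hq using Submodule.span_induction with
          | mem q hq =>
            obtain ⟨y, ψ, -, hψ, rfl⟩ := hq
            exact dyad_mul_mem h0 hφ x y hψ
          | zero => rw [zero_mul]; exact zero_mem _
          | add x y _ _ hx hy => rw [add_mul]; exact add_mem hx hy
          | smul c x _ hx => rw [Matrix.smul_mul]; exact Submodule.smul_mem _ _ hx
        | zero => rw [mul_zero]; exact zero_mem _
        | add x y _ _ hx hy => rw [mul_add]; exact add_mem hx hy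
        | smul c x _ hx => rw [Matrix.mul_smul]; exact Submodule.smul_mem _ _ hx
      | add x _ y _ hx hy => rw [add_mul]; exact add_mem hx hy
    | add x _ y _ hx hy => rw [mul_add]; exact add_mem hx hy
  | algebraMap r => rw [← Algebra.smul_def]; exact Submodule.smul_mem _ _ hm
  | add x y _ _ hx hy => rw [add_mul]; exact add_mem (hx hm) (hy hm)
  | mul x y _ _ hx hy => rw [mul_assoc]; exact hx (hy hm)

/-- Left multiplication by `x_0 ∧ ι_φ` maps the left span of the operators `x ∧ ι_φ` to the left
multiples of `x_0 ∧ ι_φ` itself. -/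
theorem dyad_single_mul_leftIdeal (h0 : φ 0 = 1) (hφ : ∑ i, φ i = 0)
    {m : Matrix (Word (n + 1)) (Word (n + 1)) k}
    (hm : m ∈ (tailAlg k n).toSubmodule * span k (Set.range fun x => dyad x φ)) :
    dyad (Pi.single 0 1) φ * m ∈
      (tailAlg k n).toSubmodule * span k {dyad (Pi.single 0 1) φ} := by
  induction hm using Submodule.mul_induction_on' with
  | mem_mul_mem b hb p hp =>
    rw [← mul_assoc]
    -- The forms of the tail algebra vanish on `x_0`, so the vector `x_0` survives the move.
    have h : dyad (Pi.single 0 1) φ * b ∈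
        (tailAlg k n).toSubmodule * dyadSpan (span k {Pi.single 0 1}) := by
      refine dyadSpan_mul_mem (fun x hx θ hθ z => ?_) hb
        (mem_toSubmodule_mul _ (subset_span ⟨_, φ, mem_span_singleton_self _, hφ, rfl⟩))
      obtain ⟨c, rfl⟩ := mem_span_singleton.1 hx
      simp [hθ]
    generalize dyad (Pi.single 0 1) φ * b = d at h
    induction h using Submodule.mul_induction_on' with
    | mem_mul_mem c hc q hq =>
      rw [mul_assoc]
      refine mul_mem_toSubmodule_mul _ hc ?_
      induction hp using Submodule.span_induction with
      | mem p hp =>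
        obtain ⟨x, rfl⟩ := hp
        induction hq using Submodule.span_induction with
        | mem q hq =>
          obtain ⟨y, ψ, hy, hψ, rfl⟩ := hq
          obtain ⟨c, rfl⟩ := mem_span_singleton.1 hy
          rw [dyad_smul_left, Matrix.smul_mul]
          exact Submodule.smul_mem _ _ (dyad_single_mul_mem h0 hφ x hψ)
        | zero => rw [zero_mul]; exact zero_mem _
        | add x y _ _ hx hy => rw [add_mul]; exact add_mem hx hy
        | smul c x _ hx => rw [Matrix.smul_mul]; exact Submodule.smul_mem _ _ hx
      | zero => rw [mul_zero]; exact zero_mem _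
      | add x y _ _ hx hy => rw [mul_add]; exact add_mem hx hy
      | smul c x _ hx => rw [Matrix.mul_smul]; exact Submodule.smul_mem _ _ hx
    | add x _ y _ hx hy => rw [add_mul]; exact add_mem hx hy
  | add x _ y _ hx hy => rw [mul_add]; exact add_mem hx hy

theorem dyad_single_idem (h0 : φ 0 = 1) :
    dyad (Pi.single 0 1) φ * dyad (Pi.single 0 1) φ = dyad (Pi.single 0 1) φ := by
  rw [dyad_mul_dyad_same_right]; simp [h0]

/-- The corner of `dyadAlg k (n + 1)` at `x_0 ∧ ι_φ` comes from the last `n` tensor factors. -/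
theorem exists_oneTensor_of_corner (h0 : φ 0 = 1) (hφ : ∑ i, φ i = 0)
    {a : Matrix (Word (n + 1)) (Word (n + 1)) k} (ha : a ∈ dyadAlg k (n + 1)) :
    ∃ b ∈ dyadAlg k n, dyad (Pi.single 0 1) φ * a * dyad (Pi.single 0 1) φ =
      oneTensor k n b * dyad (Pi.single 0 1) φ := by
  have h := dyad_single_mul_leftIdeal h0 hφ (dyadAlg_mul_mem h0 hφ ha
    (mem_toSubmodule_mul _ (subset_span ⟨Pi.single 0 1, rfl⟩)))
  obtain ⟨_, ⟨b, hb, rfl⟩, h⟩ := Submodule.mem_mul_span_singleton.1 h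
  exact ⟨b, hb, by rw [mul_assoc]; exact h.symm⟩

theorem dyad_mul_cre_zero (h0 : φ 0 = 1) : dyad (Pi.single 0 1) φ * cre k 0 = cre k 0 := by
  have h := sum_ann_mul_sum_cre φ (Pi.single 0 1)
  simp only [Pi.single_apply, ite_smul, one_smul, zero_smul, Finset.sum_ite_eq',
    Finset.mem_univ, if_true] at h
  rw [dyad_single_left, mul_assoc, h, mul_sub, ← mul_assoc (cre k 0), cre_mul_self]
  simp [dotProduct, Pi.single_apply, h0]

/-- The image of `x_0 ∧ ι_φ` is `e_2 ⊗ (k²)^{⊗ n}`, on which the last `n` factors act. -/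
theorem corner_oneTensor (h0 : φ 0 = 1) (b : Matrix (Word n) (Word n) k) :
    dyad (Pi.single 0 1) φ * oneTensor k n b * dyad (Pi.single 0 1) φ =
      oneTensor k n b * dyad (Pi.single 0 1) φ := by
  nth_rw 2 3 [dyad_single_left]
  rw [mul_assoc, ← mul_assoc (oneTensor k n b), cre_zero, ← headTensor_commute_oneTensor,
    ← cre_zero, ← mul_assoc, ← mul_assoc, dyad_mul_cre_zero h0]

theorem eq_zero_of_oneTensor_mul_dyad (h0 : φ 0 = 1) {b : Matrix (Word n) (Word n) k}
    (h : oneTensor k n b * dyad (Pi.single 0 1) φ = 0) : b = 0 := by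
  have h2 : oneTensor k n b * cre k 0 = 0 := by rw [← dyad_mul_cre_zero h0, ← mul_assoc, h, zero_mul]
  rw [cre_zero, ← headTensor_commute_oneTensor] at h2
  refine matrix_ext_mulVec fun f v => ?_
  have h3 := congrFun (congrArg (fun M => M.mulVec fun w => f (Fin.tail w)) h2) (Fin.cons 1 v)
  simpa [← Matrix.mulVec_mulVec, headTensor_mulVec, oneTensor_mulVec, raise] using h3

end Corner

/-! ### The image of the representation -/

theorem rep_of_sig (t : kˣ) {n : ℕ} (i : Fin (n - 1)) :
    rep t n (MonoidAlgebra.of k (LB n) (sig i)) = localMat (matM (t : k)) i := by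
  simp only [rep, MonoidAlgebra.lift_of, MonoidHom.comp_apply, repGroup, sig,
    PresentedGroup.toGroup.of]
  rfl

theorem rep_of_rho (t : kˣ) {n : ℕ} (i : Fin (n - 1)) :
    rep t n (MonoidAlgebra.of k (LB n) (rho i)) = localMat (matM 1) i := by
  simp only [rep, MonoidAlgebra.lift_of, MonoidHom.comp_apply, repGroup, rho,
    PresentedGroup.toGroup.of]
  rfl

theorem LB.mem_of_generators_mem {n : ℕ} (H : Subgroup (LB n)) (hs : ∀ i, sig i ∈ H)
    (hr : ∀ i, rho i ∈ H) (g : LB n) : g ∈ H := by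
  have h : Subgroup.closure (Set.range (PresentedGroup.of (rels := relators n))) ≤ H := by
    rw [Subgroup.closure_le]
    rintro _ ⟨i | i, rfl⟩
    · exact hs i
    · exact hr i
  rw [PresentedGroup.closure_range_of] at h
  exact h (Subgroup.mem_top g)

/-- The form `x_i^* - x_j^*`. -/
def diffForm {n : ℕ} (i j : Fin n) : Fin n → k := Pi.single i 1 - Pi.single j 1

theorem sum_diffForm {n : ℕ} (i j : Fin n) : ∑ l, diffForm (k := k) i j l = 0 := by
  simp [diffForm]

theorem localMat_matM_eq_dyad (s : k) {n : ℕ} (i : Fin (n - 1)) :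
    localMat (matM s) i =
      1 - (s • dyad (Pi.single (pos i) 1) (diffForm (pos i) (posSucc i)) -
        dyad (Pi.single (posSucc i) 1) (diffForm (pos i) (posSucc i))) := by
  rw [localMat_matM, dyad_single_left, dyad_single_left, ← Matrix.smul_mul, ← sub_mul]
  congr 2
  simp [diffForm, sub_smul, Pi.single_apply]

/-- The inverse of a generator is a polynomial in it by the quadratic relation, so a subalgebra that
contains the images of the generators contains the image of the group algebra. -/
theorem rep_mem_of_generators (t : kˣ) {n : ℕ} (S : Subalgebra k (Matrix (Word n) (Word n) k))
    (hS : ∀ (s : kˣ) i, localMat (matM (s : k)) i ∈ S) (a : MonoidAlgebra k (LB n)) :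
    rep t n a ∈ S := by
  have hu : ∀ (s : kˣ) (i : Fin (n - 1)), (sigUnit s i).val ∈ S ∧ (sigUnit s i)⁻¹.val ∈ S :=
    fun s i => ⟨hS s i, S.smul_mem (S.sub_mem (hS s i) (S.smul_mem S.one_mem _)) _⟩
  let H : Subgroup (LB n) :=
    { carrier := {g | (repGroup t n g).val ∈ S ∧ (repGroup t n g)⁻¹.val ∈ S}
      one_mem' := by simp
      mul_mem' := by
        rintro a b ⟨ha, ha'⟩ ⟨hb, hb'⟩
        constructor
        · rw [map_mul]; exact S.mul_mem ha hb
        · rw [map_mul, mul_inv_rev]; exact S.mul_mem hb' ha'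
      inv_mem' := by
        rintro a ⟨ha, ha'⟩
        constructor
        · rwa [map_inv]
        · rwa [map_inv, inv_inv] }
  have hg : ∀ g, g ∈ H := LB.mem_of_generators_mem H
    (fun i => by
      change (repGroup t n (sig i)).val ∈ S ∧ (repGroup t n (sig i))⁻¹.val ∈ S
      rw [repGroup, sig, PresentedGroup.toGroup.of]; exact hu t i)
    (fun i => by
      change (repGroup t n (rho i)).val ∈ S ∧ (repGroup t n (rho i))⁻¹.val ∈ S
      rw [repGroup, rho, PresentedGroup.toGroup.of]; exact hu 1 i)
  induction a using MonoidAlgebra.induction_on with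
  | of g => rw [rep, MonoidAlgebra.lift_of]; exact (hg g).1
  | add a b ha hb => rw [map_add]; exact S.add_mem ha hb
  | smul r a ha => rw [map_smul]; exact S.smul_mem ha r

theorem dyad_diffForm_trans {n : ℕ} (x : Fin n → k) (i j l : Fin n) :
    dyad x (diffForm i l) = dyad x (diffForm i j) + dyad x (diffForm j l) := by
  rw [← dyad_add_right]; simp [diffForm]

/-- Neighbouring positions connect all positions. -/
theorem position_induction {m : ℕ} {p : Fin m → Prop} (i₀ : Fin m) (h₀ : p i₀)
    (up : ∀ i : Fin (m - 1), p (pos i) → p (posSucc i))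
    (down : ∀ i : Fin (m - 1), p (posSucc i) → p (pos i)) (j : Fin m) : p j := by
  have key : ∀ (d : ℕ) (a b : Fin m), a.val + d = b.val → (p a ↔ p b) := by
    intro d
    induction d with
    | zero => intro a b h; rw [Fin.ext (by simpa using h) (a := a) (b := b)]
    | succ d ih =>
      intro a b h
      have hi : b.val - 1 < m - 1 := by omega
      have hb : b = posSucc ⟨b.val - 1, hi⟩ := Fin.ext (by simp only [posSucc]; omega)
      have h1 := ih a (pos ⟨b.val - 1, hi⟩) (by simp only [pos]; omega)
      rw [h1]
      exact ⟨fun h => hb ▸ up _ h, fun h => down _ (hb ▸ h)⟩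
  rcases le_total i₀.val j.val with h | h
  · exact (key (j.val - i₀.val) i₀ j (by omega)).1 h₀
  · exact (key (i₀.val - j.val) j i₀ (by omega)).2 h₀

/-- For `t ≠ 1` the generators yield the operators `x_i ∧ ι` and `x_{i+1} ∧ ι` separately, with `ι`
the contraction with `x_i^* - x_{i+1}^*`; their commutators yield all the others. -/
theorem rep_range_eq_dyadAlg (t : kˣ) (ht : (t : k) ≠ 1) (n : ℕ) :
    (rep t n).range = dyadAlg k n := by
  apply le_antisymm
  · rintro _ ⟨a, rfl⟩
    refine rep_mem_of_generators t _ (fun s i => ?_) a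
    rw [localMat_matM_eq_dyad]
    exact sub_mem (one_mem _) (sub_mem (Subalgebra.smul_mem _
      (dyad_mem_dyadAlg _ (sum_diffForm _ _)) _) (dyad_mem_dyadAlg _ (sum_diffForm _ _)))
  set S := (rep t n).range
  have hs : ∀ i, localMat (matM (t : k)) i ∈ S := fun i => ⟨_, rep_of_sig t i⟩
  have hr : ∀ i, localMat (matM (1 : k)) i ∈ S := fun i => ⟨_, rep_of_rho t i⟩
  have h1 : ∀ i : Fin (n - 1),
      dyad (Pi.single (pos i) 1) (diffForm (pos i) (posSucc i)) ∈ S := fun i => by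
    have h := S.smul_mem (S.sub_mem (hs i) (hr i)) (1 - (t : k))⁻¹
    have ht' : (1 - (t : k)) ≠ 0 := sub_ne_zero.2 ht.symm
    rw [localMat_matM_eq_dyad, localMat_matM_eq_dyad, one_smul] at h
    convert h using 1
    rw [eq_inv_smul_iff₀ ht', sub_smul, one_smul]
    abel
  have h2 : ∀ i : Fin (n - 1),
      dyad (Pi.single (posSucc i) 1) (diffForm (pos i) (posSucc i)) ∈ S := fun i => by
    have h := S.add_mem (S.sub_mem (hr i) S.one_mem) (h1 i)
    rw [localMat_matM_eq_dyad, one_smul] at h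
    convert h using 1
    abel
  have comm : ∀ {x φ y ψ : Fin n → k}, dyad x φ ∈ S → dyad y ψ ∈ S →
      (φ ⬝ᵥ y) • dyad x ψ - (ψ ⬝ᵥ x) • dyad y φ ∈ S := fun {x φ y ψ} hx hy => by
    have h := S.sub_mem (S.mul_mem hx hy) (S.mul_mem hy hx)
    rwa [dyad_commutator x, add_sub_cancel_right] at h
  have h3 : ∀ (i : Fin (n - 1)) (c : Fin n),
      dyad (Pi.single c 1) (diffForm (pos i) (posSucc i)) ∈ S := by
    intro i c
    -- Commutators with the operators of `h1` and `h2` move the vector to neighbouring positions.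
    induction c using position_induction (pos i) with
    | h₀ => exact h1 i
    | up j hj =>
      have h := S.add_mem (comm (h2 j) hj) (S.smul_mem (h1 j)
        (diffForm (pos i) (posSucc i) ⬝ᵥ Pi.single (posSucc j) 1))
      simpa [diffForm, pos_ne j] using h
    | down j hj =>
      have h := S.add_mem (comm (h1 j) hj) (S.smul_mem (h2 j)
        (diffForm (pos i) (posSucc i) ⬝ᵥ Pi.single (pos j) 1))
      simpa [diffForm, (pos_ne j).symm] using h
  have h4 : ∀ a b c : Fin n, dyad (Pi.single c 1) (diffForm a b) ∈ S := by
    intro a b c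
    induction b using position_induction a with
    | h₀ => simp [diffForm, dyad]
    | up j hj =>
      rw [dyad_diffForm_trans _ _ (pos j)]
      exact S.add_mem hj (h3 j c)
    | down j hj =>
      rw [dyad_diffForm_trans _ _ (pos j)] at hj
      simpa using S.sub_mem hj (h3 j c)
  rw [dyadAlg, Algebra.adjoin_le_iff]
  rintro _ ⟨x, φ, hφ, rfl⟩
  rcases n with _ | n
  · simp [dyad]
  have hx : dyad x φ = ∑ c, ∑ a, x c • φ a • dyad (Pi.single c 1) (diffForm a 0) := by
    have e : ∑ i, φ i • ann k i = ∑ i, φ i • (ann k i - ann k 0) := by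
      simp only [smul_sub, Finset.sum_sub_distrib, ← Finset.sum_smul, hφ, zero_smul, sub_zero]
    rw [dyad, e, Finset.sum_mul_sum]
    refine Finset.sum_congr rfl fun c _ => Finset.sum_congr rfl fun a _ => ?_
    rw [dyad_single_left, Matrix.smul_mul, Matrix.mul_smul]
    congr 3
    simp [diffForm, sub_smul, Pi.single_apply]
  rw [hx]
  exact S.sum_mem fun c _ => S.sum_mem fun a _ => S.smul_mem (S.smul_mem (h4 a 0 c) _) _

/-! ### The corner of `SP_n` -/

/-- The faithful matrix representation of `SP_n`. -/
noncomputable def SP.toMatrix (t : kˣ) (n : ℕ) : SP t n →ₐ[k] Matrix (Word n) (Word n) k :=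
  Ideal.Quotient.liftₐ (RingHom.ker (rep t n)) (rep t n) fun _ h => h

theorem SP.toMatrix_mk (t : kˣ) {n : ℕ} (a : MonoidAlgebra k (LB n)) :
    SP.toMatrix t n (Ideal.Quotient.mk _ a) = rep t n a := rfl

theorem SP.toMatrix_injective (t : kˣ) (n : ℕ) : Function.Injective (SP.toMatrix t n) := by
  rw [injective_iff_map_eq_zero]
  intro x hx
  obtain ⟨a, rfl⟩ := Ideal.Quotient.mk_surjective x
  exact Ideal.Quotient.eq_zero_iff_mem.2 hx

theorem SP.exists_toMatrix_iff (t : kˣ) (ht : (t : k) ≠ 1) {n : ℕ}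
    (a : Matrix (Word n) (Word n) k) : (∃ x, SP.toMatrix t n x = a) ↔ a ∈ dyadAlg k n := by
  rw [← rep_range_eq_dyadAlg t ht]
  constructor
  · rintro ⟨x, rfl⟩
    obtain ⟨a, rfl⟩ := Ideal.Quotient.mk_surjective x
    exact ⟨a, rfl⟩
  · rintro ⟨a, rfl⟩
    exact ⟨Ideal.Quotient.mk _ a, rfl⟩

theorem SP.toMatrix_translate (t : kˣ) (n : ℕ) (x : SP t n) :
    SP.toMatrix t (n + 1) (SP.translate t n x) = oneTensor k n (SP.toMatrix t n x) := by
  obtain ⟨a, rfl⟩ := Ideal.Quotient.mk_surjective x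
  exact rep_shift t n a

theorem SP.toMatrix_chi (t : kˣ) (ht : (t : k) ≠ 1) {n : ℕ} (i : Fin (n - 1)) :
    SP.toMatrix t n (SP.chi t i) = dyad (Pi.single (pos i) 1) (diffForm (pos i) (posSucc i)) := by
  have ht' : (1 - (t : k)) ≠ 0 := sub_ne_zero.2 ht.symm
  rw [SP.chi, map_smul, map_sub, SP.ofLB, SP.ofLB, SP.toMatrix_mk, SP.toMatrix_mk, rep_of_sig,
    rep_of_rho, localMat_matM_eq_dyad, localMat_matM_eq_dyad, one_smul, inv_smul_eq_iff₀ ht',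
    sub_smul, one_smul]
  abel

theorem SP.toMatrix_chiOne (t : kˣ) (ht : (t : k) ≠ 1) {n : ℕ} (hn : 1 ≤ n) :
    ∃ φ : Fin (n + 1) → k, φ 0 = 1 ∧ ∑ i, φ i = 0 ∧
      SP.toMatrix t (n + 1) (SP.chiOne t hn) = dyad (Pi.single 0 1) φ := by
  refine ⟨_, ?_, sum_diffForm _ _, SP.toMatrix_chi t ht _⟩
  change (Pi.single (0 : Fin (n + 1)) (1 : k) - Pi.single _ 1 : Fin (n + 1) → k) 0 = 1
  simp [posSucc]

theorem SP.chiOne_idem (t : kˣ) (ht : (t : k) ≠ 1) {n : ℕ} (hn : 1 ≤ n) :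
    IsIdempotentElem (SP.chiOne t hn) := by
  obtain ⟨φ, h0, hφ, h⟩ := SP.toMatrix_chiOne t ht hn
  apply SP.toMatrix_injective
  rw [map_mul, h, dyad_single_idem h0]

theorem SP.chiOne_translate_chiOne (t : kˣ) (ht : (t : k) ≠ 1) {n : ℕ} (hn : 1 ≤ n) (w : SP t n) :
    SP.chiOne t hn * SP.translate t n w * SP.chiOne t hn =
      SP.translate t n w * SP.chiOne t hn := by
  obtain ⟨φ, h0, hφ, h⟩ := SP.toMatrix_chiOne t ht hn
  apply SP.toMatrix_injective
  simp only [map_mul, h, SP.toMatrix_translate, corner_oneTensor h0]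

/-- Compression to the corner, as an algebra map. -/
noncomputable def SP.cornerHom (t : kˣ) (ht : (t : k) ≠ 1) {n : ℕ} (hn : 1 ≤ n) :
    SP t n →ₐ[k] (SP.chiOne_idem t ht hn).Corner :=
  AlgHom.ofLinearMap
    { toFun := fun w => ⟨SP.chiOne t hn * SP.translate t n w * SP.chiOne t hn, _, rfl⟩
      map_add' := fun x y => Subtype.ext (by
        change SP.chiOne t hn * SP.translate t n (x + y) * SP.chiOne t hn =
          SP.chiOne t hn * SP.translate t n x * SP.chiOne t hn +
          SP.chiOne t hn * SP.translate t n y * SP.chiOne t hn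
        rw [map_add, mul_add, add_mul])
      map_smul' := fun c x => Subtype.ext (by
        change SP.chiOne t hn * SP.translate t n (c • x) * SP.chiOne t hn =
          c • (SP.chiOne t hn * SP.translate t n x * SP.chiOne t hn)
        rw [map_smul, mul_smul_comm, smul_mul_assoc]) }
    (Subtype.ext (by
      change SP.chiOne t hn * SP.translate t n 1 * SP.chiOne t hn = SP.chiOne t hn
      rw [map_one, mul_one, (SP.chiOne_idem t ht hn).eq]))
    (fun x y => Subtype.ext (by
      change SP.chiOne t hn * SP.translate t n (x * y) * SP.chiOne t hn =
        (SP.chiOne t hn * SP.translate t n x * SP.chiOne t hn) *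
          (SP.chiOne t hn * SP.translate t n y * SP.chiOne t hn)
      have h := SP.chiOne_translate_chiOne t ht hn
      rw [h (x * y), h x, h y, mul_assoc (SP.translate t n x), ← mul_assoc (SP.chiOne t hn),
        h y, map_mul, mul_assoc]))

theorem SP.cornerHom_val (t : kˣ) (ht : (t : k) ≠ 1) {n : ℕ} (hn : 1 ≤ n) (w : SP t n) :
    (SP.cornerHom t ht hn w).val =
      SP.chiOne t hn * SP.translate t n w * SP.chiOne t hn := rfl

theorem SP.cornerHom_bijective (t : kˣ) (ht : (t : k) ≠ 1) {n : ℕ} (hn : 1 ≤ n) :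
    Function.Bijective (SP.cornerHom t ht hn) := by
  obtain ⟨φ, h0, hφ, h⟩ := SP.toMatrix_chiOne t ht hn
  constructor
  · rw [injective_iff_map_eq_zero]
    intro w hw
    have hw' : SP.translate t n w * SP.chiOne t hn = 0 := by
      rw [← SP.chiOne_translate_chiOne t ht, ← SP.cornerHom_val t ht, hw]
      rfl
    have h1 := congrArg (SP.toMatrix t (n + 1)) hw'
    rw [map_mul, h, SP.toMatrix_translate, map_zero] at h1
    exact SP.toMatrix_injective t n ((eq_zero_of_oneTensor_mul_dyad h0 h1).trans (map_zero _).symm)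
  · rintro ⟨_, a, rfl⟩
    obtain ⟨b, hb, hab⟩ := exists_oneTensor_of_corner h0 hφ
      ((SP.exists_toMatrix_iff t ht _).1 ⟨a, rfl⟩)
    obtain ⟨w, rfl⟩ := (SP.exists_toMatrix_iff t ht b).2 hb
    refine ⟨w, Subtype.ext (SP.toMatrix_injective t _ ?_)⟩
    rw [SP.cornerHom_val, SP.chiOne_translate_chiOne t ht]
    simp only [map_mul, h, SP.toMatrix_translate]
    exact hab.symm

/-! ### The quotient by the ideal generated by `χ_1` -/

theorem SP.ofLB_mul (t : kˣ) {n : ℕ} (g h : LB n) :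
    SP.ofLB t (g * h) = SP.ofLB t g * SP.ofLB t h := by
  simp only [SP.ofLB, map_mul]

theorem SP.ofLB_one (t : kˣ) {n : ℕ} : SP.ofLB t (1 : LB n) = 1 := by
  simp only [SP.ofLB, map_one]

/-- The augmentation `SP_n → k`, through which `SP_n` acts on the line of `e_1 ⊗ ⋯ ⊗ e_1`. -/
theorem SP.exists_augmentation (t : kˣ) (n : ℕ) :
    ∃ ε : SP t n →ₐ[k] k, ∀ g, ε (SP.ofLB t g) = 1 := by
  let vac : Word n → k := Pi.single 0 1
  have hvac : ∀ g : LB n, (repGroup t n g).val.mulVec vac = vac := by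
    let H : Subgroup (LB n) :=
      { carrier := {g | (repGroup t n g).val.mulVec vac = vac}
        one_mem' := by simp
        mul_mem' := by
          intro a b ha hb
          change Matrix.mulVec _ _ = _ at ha hb
          change Matrix.mulVec _ _ = _
          rw [map_mul, Units.val_mul, ← Matrix.mulVec_mulVec, hb, ha]
        inv_mem' := by
          intro a ha
          change Matrix.mulVec _ _ = _ at ha
          change Matrix.mulVec _ _ = _
          rw [map_inv]
          nth_rw 1 [← ha]
          rw [Matrix.mulVec_mulVec, Units.inv_mul, Matrix.one_mulVec] }
    have h2 : ∀ x : Fin 2, x = 0 ∨ x = 1 := by decide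
    have hgen : ∀ (s : kˣ) (i : Fin (n - 1)), (localMat (matM (s : k)) i).mulVec vac = vac := by
      intro s i
      funext v
      have hz : ∀ {w : Word n} (j : Fin n), w j = 1 → vac w = 0 := by
        intro w j hj
        refine Pi.single_eq_of_ne ?_ _
        rintro rfl
        exact absurd hj (by simp)
      rw [matM_mulVec]
      rcases h2 (v (pos i)) with h | h <;> rcases h2 (v (posSucc i)) with h' | h' <;>
        simp only [h, h', if_true, one_ne_zero, if_false]
      · rw [hz (pos i) (by simp [pos_ne i]), hz (posSucc i) h']
      · rw [hz (pos i) h, hz (posSucc i) (by simp), mul_zero, mul_zero, add_zero]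
      · rw [hz (pos i) h, mul_zero]
    exact LB.mem_of_generators_mem H
      (fun i => by
        change Matrix.mulVec _ _ = _
        rw [repGroup, sig, PresentedGroup.toGroup.of]; exact hgen t i)
      (fun i => by
        change Matrix.mulVec _ _ = _
        rw [repGroup, rho, PresentedGroup.toGroup.of]; exact hgen 1 i)
  let ε : MonoidAlgebra k (LB n) →ₐ[k] k := MonoidAlgebra.lift k k (LB n) 1
  have key : ∀ a, (rep t n a).mulVec vac = ε a • vac := by
    intro a
    induction a using MonoidAlgebra.induction_on with
    | of g =>
      rw [rep, MonoidAlgebra.lift_of, MonoidAlgebra.lift_of, MonoidHom.one_apply, one_smul]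
      exact hvac g
    | add a b ha hb => rw [map_add, map_add, Matrix.add_mulVec, ha, hb, add_smul]
    | smul r a ha => rw [map_smul, map_smul, Matrix.smul_mulVec, ha, smul_assoc]
  refine ⟨Ideal.Quotient.liftₐ (RingHom.ker (rep t n)) ε fun a ha => ?_, fun g => ?_⟩
  · have h := key a
    rw [show rep t n a = 0 from ha, Matrix.zero_mulVec] at h
    have h0 := congrFun h 0
    simpa [vac] using h0.symm
  · change ε (MonoidAlgebra.of k (LB n) g) = 1
    rw [MonoidAlgebra.lift_of, MonoidHom.one_apply]

/-- If an algebra map kills `χ_1`, then it sends every loop braid to `1`. -/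
theorem SP.map_ofLB_eq_one (t : kˣ) (ht : (t : k) ≠ 1) {n : ℕ} (hn : 1 ≤ n) {Q : Type*} [Ring Q]
    [Algebra k Q] (q : SP t (n + 1) →ₐ[k] Q) (hq : q (SP.chiOne t hn) = 0) (g : LB (n + 1)) :
    q (SP.ofLB t g) = 1 := by
  have ht' : (1 - (t : k)) ≠ 0 := sub_ne_zero.2 ht.symm
  let G : LB (n + 1) →* Q :=
    { toFun := fun g => q (SP.ofLB t g)
      map_one' := by rw [SP.ofLB_one, map_one]
      map_mul' := fun g h => by rw [SP.ofLB_mul, map_mul] }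
  let U : LB (n + 1) →* Qˣ := G.toHomUnits
  let i₀ : Fin (n + 1 - 1) := ⟨0, hn⟩
  have hsr : G (sig i₀) = G (rho i₀) := by
    change q (SP.ofLB t (sig i₀)) = q (SP.ofLB t (rho i₀))
    have h : (1 - (t : k))⁻¹ • (q (SP.ofLB t (sig i₀)) - q (SP.ofLB t (rho i₀))) = 0 := by
      rw [← map_sub, ← map_smul]; exact hq
    exact sub_eq_zero.1 ((smul_eq_zero_iff_right (inv_ne_zero ht')).1 h)
  have hecke : G (sig i₀) * G (sig i₀) = (1 - (t : k)) • G (sig i₀) + (t : k) • 1 := by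
    change q (SP.ofLB t (sig i₀)) * q (SP.ofLB t (sig i₀)) =
      (1 - (t : k)) • q (SP.ofLB t (sig i₀)) + (t : k) • 1
    rw [← map_mul, ← map_smul, ← map_one q, ← map_smul, ← map_add]
    congr 1
    apply SP.toMatrix_injective
    simp only [map_mul, map_add, map_smul, map_one, SP.ofLB, SP.toMatrix_mk, rep_of_sig,
      localMat_sq]
  have relG : ∀ {l r : FreeGroup (Gen (n + 1))}, Rel (n + 1) l r →
      PresentedGroup.mk (relators (n + 1)) l = PresentedGroup.mk (relators (n + 1)) r := by
    intro l r h
    have h1 : PresentedGroup.mk (relators (n + 1)) (l * r⁻¹) = 1 :=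
      PresentedGroup.one_of_mem ⟨l, r, h, rfl⟩
    rwa [map_mul, map_inv, mul_inv_eq_one] at h1
  have hrho0 : G (rho i₀) = 1 := by
    have h1 : G (rho i₀) * G (rho i₀) = 1 := by
      rw [← map_mul, ← map_one G]
      exact congrArg G (relG (Rel.rho_sq i₀))
    -- The two quadratic relations agree only at the eigenvalue `1`.
    rw [hsr, h1] at hecke
    have h2 : (1 - (t : k)) • (G (rho i₀) - 1) = 0 := by
      rw [smul_sub, sub_eq_zero]
      rw [← sub_eq_iff_eq_add] at hecke
      rw [← hecke, sub_smul, one_smul]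
    exact sub_eq_zero.1 ((smul_eq_zero_iff_right ht').1 h2)
  have hval : ∀ g, G g = 1 ↔ U g = 1 := fun g => by rw [← Units.val_eq_one]; rfl
  have hall : ∀ (m : ℕ) (hm : m < n + 1 - 1),
      U (rho (⟨m, hm⟩ : Fin (n + 1 - 1))) = 1 ∧ U (sig (⟨m, hm⟩ : Fin (n + 1 - 1))) = 1 := by
    intro m
    induction m with
    | zero => exact fun hm => ⟨(hval _).1 hrho0, (hval _).1 (hsr.trans hrho0)⟩
    | succ m ih =>
      intro hm
      obtain ⟨ir, is⟩ := ih (by omega)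
      constructor
      · have h := congrArg U (relG (Rel.rho_braid ⟨m, by omega⟩ ⟨m + 1, hm⟩ rfl))
        change U (rho _ * rho _ * rho _) = U (rho _ * rho _ * rho _) at h
        simpa [ir] using h
      · have h := congrArg U (relG (Rel.sig_braid ⟨m, by omega⟩ ⟨m + 1, hm⟩ rfl))
        change U (sig _ * sig _ * sig _) = U (sig _ * sig _ * sig _) at h
        simpa [is] using h
  exact (hval g).2 (LB.mem_of_generators_mem U.ker (fun i => (hall i.1 i.2).2)
    (fun i => (hall i.1 i.2).1) g)

theorem SP.nonempty_quotient_equiv (t : kˣ) (ht : (t : k) ≠ 1) {n : ℕ} (hn : 1 ≤ n) :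
    Nonempty ((TwoSidedIdeal.span {SP.chiOne t hn}).ringCon.Quotient ≃ₐ[k] k) := by
  set I := TwoSidedIdeal.span {SP.chiOne t hn}
  let q : SP t (n + 1) →ₐ[k] I.ringCon.Quotient :=
    { I.ringCon.mk' with commutes' := fun _ => rfl }
  have hq : ∀ x, q x = 0 ↔ x ∈ I := fun x => by
    change I.ringCon.mk' x = 0 ↔ _
    rw [← TwoSidedIdeal.mem_ker, TwoSidedIdeal.ker_ringCon_mk']
  have hone := SP.map_ofLB_eq_one t ht hn q
    ((hq _).2 (TwoSidedIdeal.subset_span (Set.mem_singleton _)))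
  have hsurj : Function.Surjective (Algebra.ofId k I.ringCon.Quotient) := by
    intro y
    obtain ⟨x, rfl⟩ : ∃ x, q x = y := I.ringCon.mk'_surjective y
    obtain ⟨a, rfl⟩ := Ideal.Quotient.mk_surjective x
    induction a using MonoidAlgebra.induction_on with
    | of g => exact ⟨1, by rw [map_one]; exact (hone g).symm⟩
    | add a b ha hb =>
      obtain ⟨c, hc⟩ := ha
      obtain ⟨d, hd⟩ := hb
      exact ⟨c + d, by rw [map_add, hc, hd, map_add, map_add]⟩
    | smul r a ha =>
      obtain ⟨c, hc⟩ := ha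
      exact ⟨r • c, by rw [map_smul, hc, ← map_smul]; rfl⟩
  have hinj : Function.Injective (Algebra.ofId k I.ringCon.Quotient) := by
    obtain ⟨ε, hε⟩ := SP.exists_augmentation t (n + 1)
    have hle : I ≤ TwoSidedIdeal.ker ε := by
      rw [TwoSidedIdeal.span_le, Set.singleton_subset_iff]
      change SP.chiOne t hn ∈ TwoSidedIdeal.ker ε
      rw [TwoSidedIdeal.mem_ker, SP.chiOne, SP.chi, map_smul, map_sub, hε, hε, sub_self, smul_zero]
    rw [injective_iff_map_eq_zero]
    intro c hc
    have h : q (algebraMap k _ c) = 0 := by rw [AlgHom.commutes]; exact hc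
    have h' := (TwoSidedIdeal.mem_ker _).1 (hle ((hq _).1 h))
    rwa [AlgHom.commutes] at h'
  exact ⟨(AlgEquiv.ofBijective (Algebra.ofId k _) ⟨hinj, hsurj⟩).symm⟩

end LoopBraid

theorem mainTheorem3 {k : Type*} [Field k] (t : kˣ) (ht : (t : k) ≠ 1) (n : ℕ) (hn : 1 ≤ n) :
    (∃ (hχ : IsIdempotentElem (LoopBraid.SP.chiOne t hn))
        (f : LoopBraid.SP t n ≃ₐ[k] hχ.Corner),
      ∀ w : LoopBraid.SP t n, (f w).val =
        LoopBraid.SP.chiOne t hn * LoopBraid.SP.translate t n w * LoopBraid.SP.chiOne t hn) ∧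
    Nonempty ((TwoSidedIdeal.span {LoopBraid.SP.chiOne t hn}).ringCon.Quotient ≃ₐ[k] k) :=
  ⟨⟨LoopBraid.SP.chiOne_idem t ht hn,
    AlgEquiv.ofBijective (LoopBraid.SP.cornerHom t ht hn) (LoopBraid.SP.cornerHom_bijective t ht hn),
    fun _ => rfl⟩, LoopBraid.SP.nonempty_quotient_equiv t ht hn⟩
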